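/- Let $d\ge 1$. For $f,g\in L^2(\mathbb R^d)$ let $W(f,g)(x,\xi)=\int_{\mathbb R^d}f(x+\tfrac t2)\overline{g(x-\tfrac t2)}e^{-2\pi i\xi\cdot t}\,dt$, $(x,\xi)\in\mathbb R^{2d}$, be the cross-Wigner distribution. Let $\vartheta=(\vartheta_1,\dots,\vartheta_d)\in\mathbb R^d$ and let $\mathcal F_\vartheta$ be a fractional Fourier transform, i.e. a metaplectic operator with projection $$S_\vartheta=\begin{pmatrix}\operatorname{diag}(\cos\vartheta_j)&\operatorname{diag}(\sin\vartheta_j)\\-\operatorname{diag}(\sin\vartheta_j)&\operatorname{diag}(\cos\vartheta_j)\end{pmatrix},$$ which means that $\mathcal F_\vartheta$ is a unitary operator on $L^2(\mathbb R^d)$ with $W(\mathcal F_\vartheta f,\mathcal F_\vartheta g)(z)=W(f,g)(S_\vartheta^{-1}z)$ for all $f,g\in L^2(\mathbb R^d)$ and $z\in\mathbb R^{2d}$ (this determines $\mathcal F_\vartheta$ up to a constant factor of modulus one). Put $\mathcal J=\{j:\sin\vartheta_j\ne0\}$, $\mathcal J^c=\{1,\dots,d\}\setminus\mathcal J$, and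 assume $\mathcal J\neq\emptyset$. For $x\in\mathbb R^d$ write $x_{\mathcal J}=(x_j)_{j\in\mathcal J}\in\mathbb R^{\mathcal J}$ and $x_{\mathcal J^c}=(x_j)_{j\in\mathcal J^c}\in\mathbb R^{\mathcal J^c}$. Let $a,b>0$ and let $f\in L^2(\mathbb R^d)\setminus\{0\}$ satisfy $$|f(x)|\le\alpha(x_{\mathcal J^c})\,e^{-\pi a|x_{\mathcal J}|^2}\quad\text{for a.e. }x\in\mathbb R^d,\qquad |\mathcal F_\vartheta f(\xi)|\le\beta(\xi_{\mathcal J^c})\,e^{-\pi b|\xi_{\mathcal J}|^2}\quad\text{for a.e. }\xi\in\mathbb R^d,$$ for some functions $\alpha,\beta:\mathbb R^{\mathcal J^c}\to(0,+\infty)$. Then: (i) $ab\sin^2\vartheta_j\le1$ for every $1\le j\le d$. (ii) If $\sin^2\vartheta_j=1/(ab)$ for every $j\in\mathcal J$, then there is $\gamma\in L^2(\mathbb R^{\mathcal J^c})$ such that $$f(x)=\gamma(x_{\mathcal J^c})\prod_{j\in\mathcal J}e^{-\pi(a+i\cot\vartheta_j)x_j^2}\qquad\text{for a.e. }x\in\mathbb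 R^d.$$ (If $\mathcal J^c=\emptyset$, then $\mathbb R^{\mathcal J^c}$ is a point and $\alpha,\beta,\gamma$ are constants.) -/

import Mathlib

open MeasureTheory

noncomputable section

namespace FracFourierHardy

/-- `L²(ℝᵈ; ℂ)` with respect to Lebesgue measure. -/
abbrev L2 (d : ℕ) : Type :=
  Lp ℂ 2 (volume : Measure (EuclideanSpace ℝ (Fin d)))

/-- The cross-Wigner distribution
`W(f,g)(x,ξ) = ∫ f(x + t/2) conj(g(x - t/2)) e^{-2πi ξ·t} dt`. -/
def crossWigner {d : ℕ} (f g : EuclideanSpace ℝ (Fin d) → ℂ)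
    (x ξ : EuclideanSpace ℝ (Fin d)) : ℂ :=
  ∫ t : EuclideanSpace ℝ (Fin d),
    f (x + (1 / 2 : ℝ) • t) * (starRingEnd ℂ) (g (x - (1 / 2 : ℝ) • t)) *
      Complex.exp (-2 * Real.pi * Complex.I * (inner ℝ ξ t : ℝ))

/-- The position component `x` of a phase-space point `z = (x, ξ)`. -/
def pos {d : ℕ} (z : Fin d ⊕ Fin d → ℝ) : EuclideanSpace ℝ (Fin d) :=
  WithLp.toLp 2 fun j => z (Sum.inl j)

/-- The momentum component `ξ` of a phase-space point `z = (x, ξ)`. -/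
def mom {d : ℕ} (z : Fin d ⊕ Fin d → ℝ) : EuclideanSpace ℝ (Fin d) :=
  WithLp.toLp 2 fun j => z (Sum.inr j)

/-- The unitary operator `U` on `L²(ℝᵈ)` is a metaplectic operator with projection the symplectic
matrix `S`: `W(Uf, Ug)(z) = W(f, g)(S⁻¹ z)` for all `f, g ∈ L²(ℝᵈ)` and all `z ∈ ℝ²ᵈ`.
(This determines `U` up to a constant factor of modulus one.) -/
def IsMetaplectic {d : ℕ} (S : Matrix.symplecticGroup (Fin d) ℝ) (U : L2 d ≃ₗᵢ[ℂ] L2 d) : Prop :=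
  ∀ (f g : L2 d) (z : Fin d ⊕ Fin d → ℝ),
    crossWigner (U f) (U g) (pos z) (mom z) =
      crossWigner f g
        (pos (Matrix.mulVec (S : Matrix (Fin d ⊕ Fin d) (Fin d ⊕ Fin d) ℝ)⁻¹ z))
        (mom (Matrix.mulVec (S : Matrix (Fin d ⊕ Fin d) (Fin d ⊕ Fin d) ℝ)⁻¹ z))

/-- The matrix `S_θ` with blocks `A = D = diag(cos θ_j)`, `B = diag(sin θ_j)`, `C = -B`. -/
def fracMatrix {d : ℕ} (θ : Fin d → ℝ) : Matrix (Fin d ⊕ Fin d) (Fin d ⊕ Fin d) ℝ :=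
  Matrix.fromBlocks
    (Matrix.diagonal fun j => Real.cos (θ j)) (Matrix.diagonal fun j => Real.sin (θ j))
    (-Matrix.diagonal fun j => Real.sin (θ j)) (Matrix.diagonal fun j => Real.cos (θ j))

theorem fracMatrix_mem {d : ℕ} (θ : Fin d → ℝ) :
    fracMatrix θ ∈ Matrix.symplecticGroup (Fin d) ℝ := by
  have h : ∀ x : ℝ, Real.cos x * Real.cos x + Real.sin x * Real.sin x = 1 := fun x => by
    nlinarith [Real.sin_sq_add_cos_sq x]
  rw [SymplecticGroup.mem_iff]
  unfold fracMatrix Matrix.J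
  simp only [Matrix.fromBlocks_transpose, Matrix.fromBlocks_multiply, Matrix.diagonal_transpose,
    Matrix.transpose_neg, Matrix.mul_zero, Matrix.mul_one, Matrix.mul_neg, Matrix.neg_mul,
    Matrix.diagonal_mul_diagonal, zero_add, add_zero, neg_neg]
  congr 1 <;> ext i j <;> by_cases hij : i = j <;>
    simp [Matrix.diagonal, Matrix.one_apply, hij] <;> linarith [h (θ j)]

/-- `S_θ` as an element of the symplectic group. -/
def fracSymplectic {d : ℕ} (θ : Fin d → ℝ) : Matrix.symplecticGroup (Fin d) ℝ :=
  ⟨fracMatrix θ, fracMatrix_mem θ⟩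

/-- `U` is a fractional Fourier transform `F_θ`: a metaplectic operator with projection `S_θ`. -/
def IsFracFourier {d : ℕ} (θ : Fin d → ℝ) (U : L2 d ≃ₗᵢ[ℂ] L2 d) : Prop :=
  IsMetaplectic (fracSymplectic θ) U

/-- The index set `𝒥 = {j : sin θ_j ≠ 0}`. -/
def sinIdx {d : ℕ} (θ : Fin d → ℝ) : Finset (Fin d) :=
  Finset.univ.filter fun j => Real.sin (θ j) ≠ 0

/-- The coordinates of `x` indexed by `s`; the coordinate subspace
`Γ_s = {x ∈ ℝᵈ : x_j = 0 for j ∉ s}` is identified with `ℝˢ`. -/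
def coords {d : ℕ} (s : Finset (Fin d)) (x : EuclideanSpace ℝ (Fin d)) : EuclideanSpace ℝ s :=
  WithLp.toLp 2 fun j => x j

end FracFourierHardy

end

open MeasureTheory FracFourierHardy

open MeasureTheory FracFourierHardy

namespace FracFourierHardy

open Filter
open scoped Topology FourierTransform ContDiff SchwartzMap

/-! Write s_j = sin θ_j and c_j = cos θ_j. Where s_j ≠ 0 the operator should be an integral operator
whose kernel is a unimodular quadratic exponential: a Fourier transform sampled at u_j / s_j,
between two chirps. Where s_j = 0 it should be the reflection by ε_j = c_j = ±1. Hence, for almost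
every fixed y in the remaining coordinates, Hardy's theorem applies to the slice f(·, y) times a
chirp, with rates a and b s_j².

Only the Wigner covariance is given, not the kernel, and α, β need not be measurable, so the kernel
is recovered slice by slice. `wig_slice_ae_eq` passes the covariance to pairs of slices.
`tensor_ae_eq_of_wig_eq` inverts the Fourier transform defining the Wigner distribution: G ⊗ conj G'
is a positive multiple of P ⊗ conj P', with P, P' the fractional Fourier integrals of the slices of
f. Fixing one slice and one point where P' ≠ 0 and dividing, `fracInt_slice_bound` hands the decay
of U f to P.

The Hardy part works one coordinate at a time. Decay at rate a makes the transform entire with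
growth exp((π/a) (Im ζ)²); if a b s_j² ≥ 1 it decays at least like exp(-(π/a) x²) on the real line,
and Phragmén–Lindelöf with Liouville forces a Gaussian (`eq_gaussian_of_entire_bounds`,
`fourier_eq_update_mul_gaussian`). A strict inequality in one coordinate kills the function
(`ae_eq_zero_of_hardy`); equality in all of them leaves a Gaussian (`ae_eq_gaussian_of_hardy`),
whose coefficient as a function of y is γ. -/

/-! ### Fourier inversion and uniqueness for integrable functions -/

/-- Fourier inversion almost everywhere for integrable functions with integrable transform. -/
theorem ae_eq_fourierInv_of_fourier_ae_eq {V : Type*} [NormedAddCommGroup V]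
    [InnerProductSpace ℝ V] [FiniteDimensional ℝ V] [MeasurableSpace V] [BorelSpace V]
    {h R : V → ℂ} (hh : Integrable h) (hR : Integrable R) (hhR : 𝓕 h =ᵐ[volume] R) :
    h =ᵐ[volume] 𝓕⁻ R := by
  have hcont : Continuous (𝓕⁻ R) := by
    rw [show 𝓕⁻ R = fun v => 𝓕 R (-v) from funext fun v => Real.fourierInv_eq_fourier_neg R v]
    exact (VectorFourier.fourierIntegral_continuous Real.continuous_fourierChar
      (by exact continuous_inner) hR).comp continuous_neg
  -- A test function is the transform of a Schwartz function, so the pairing with h moves onto 𝓕 h,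
  -- which may be replaced by R.
  refine ae_eq_of_integral_contDiff_smul_eq hh.locallyIntegrable hcont.locallyIntegrable ?_
  intro g hg hgs
  have hsm : ContDiff ℝ ∞ (fun x => (g x : ℂ)) := Complex.ofRealCLM.contDiff.comp hg
  have hsupp : HasCompactSupport (fun x => (g x : ℂ)) :=
    hgs.comp_left (g := fun r : ℝ => (r : ℂ)) (by simp)
  let ψ : 𝓢(V, ℂ) := hsupp.toSchwartzMap hsm
  have hψ : ∀ x, ψ x = (g x : ℂ) := fun x => rfl
  have flip : ∀ {u v : V → ℂ}, Integrable u → Integrable v →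
      ∫ ξ, 𝓕 u ξ * v ξ = ∫ x, u x * 𝓕 v x := by
    intro u v hu hv
    have := VectorFourier.integral_fourierIntegral_smul_eq_flip (μ := (volume : Measure V))
      (ν := (volume : Measure V)) (L := innerₗ V)
      Real.continuous_fourierChar continuous_inner hu hv
    rw [flip_innerₗ] at this
    exact this
  have key : 𝓕 (𝓕⁻ ψ : 𝓢(V, ℂ)) = ψ := FourierTransform.fourier_fourierInv_eq ψ
  have key' : ∀ x, 𝓕 ((𝓕⁻ ψ : 𝓢(V, ℂ)) : V → ℂ) x = ψ x := by
    intro x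
    rw [← SchwartzMap.fourier_coe, key]
  have hinv : ∀ x, (𝓕⁻ ψ : 𝓢(V, ℂ)) x = 𝓕 (ψ : V → ℂ) (-x) := by
    intro x
    rw [SchwartzMap.fourierInv_coe, Real.fourierInv_eq_fourier_neg]
  calc ∫ x, g x • h x = ∫ x, h x * 𝓕 ((𝓕⁻ ψ : 𝓢(V, ℂ)) : V → ℂ) x := by
        congr 1 with x; rw [key', hψ, mul_comm]; simp
    _ = ∫ x, 𝓕 h x * (𝓕⁻ ψ : 𝓢(V, ℂ)) x := (flip hh (𝓕⁻ ψ : 𝓢(V, ℂ)).integrable).symm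
    _ = ∫ x, R x * 𝓕 (ψ : V → ℂ) (-x) := by
        refine integral_congr_ae ?_
        filter_upwards [hhR] with x hx
        rw [hx, hinv]
    _ = ∫ x, R (-x) * 𝓕 (ψ : V → ℂ) x := by
        rw [← integral_neg_eq_self]; simp
    _ = ∫ x, 𝓕 (fun x => R (-x)) x * ψ x := (flip hR.comp_neg ψ.integrable).symm
    _ = ∫ x, g x • 𝓕⁻ R x := by
        congr 1 with x
        rw [Real.fourierInv_eq_fourier_comp_neg, hψ, mul_comm]; simp

/-- The unitary character `r ↦ exp(-2πi r)`. -/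
noncomputable def chr (r : ℝ) : ℂ := Complex.exp (-2 * Real.pi * Complex.I * r)

theorem chr_add (r s : ℝ) : chr (r + s) = chr r * chr s := by
  simp only [chr, ← Complex.exp_add]; congr 1; push_cast; ring

theorem chr_zero : chr 0 = 1 := by simp [chr]

@[simp] theorem norm_chr (r : ℝ) : ‖chr r‖ = 1 := by
  simp [chr, Complex.norm_exp]

theorem conj_chr (r : ℝ) : (starRingEnd ℂ) (chr r) = chr (-r) := by
  simp only [chr, ← Complex.exp_conj, map_mul, map_neg, Complex.conj_ofReal,
    Complex.conj_I, Complex.conj_ofNat, Complex.ofReal_neg]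
  congr 1; ring

@[fun_prop]
theorem continuous_chr : Continuous chr := by unfold chr; fun_prop

theorem fourier_toLp_eq {ι : Type*} [Fintype ι] (h : EuclideanSpace ℝ ι → ℂ) (ξ : ι → ℝ) :
    𝓕 h (WithLp.toLp 2 ξ) = ∫ t : ι → ℝ, h (WithLp.toLp 2 t) * chr (ξ ⬝ᵥ t) := by
  rw [Real.fourier_eq']
  rw [← (PiLp.volume_preserving_toLp ι).integral_comp (MeasurableEquiv.toLp 2 _).measurableEmbedding]
  congr 1 with t
  rw [smul_eq_mul, mul_comm]
  congr 1
  simp only [chr, EuclideanSpace.inner_toLp_toLp]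
  congr 1
  simp; ring

/-- Fourier inversion almost everywhere on `ι → ℝ`. -/
theorem ae_eq_integral_of_integral_chr_ae_eq {ι : Type*} [Fintype ι] {h R : (ι → ℝ) → ℂ}
    (hh : Integrable h) (hR : Integrable R)
    (hhR : ∀ᵐ ξ, ∫ t, h t * chr (ξ ⬝ᵥ t) = R ξ) :
    ∀ᵐ t, h t = ∫ ξ, R ξ * chr (-(t ⬝ᵥ ξ)) := by
  have mp := PiLp.volume_preserving_toLp ι
  have mp' := PiLp.volume_preserving_ofLp ι
  have hh' : Integrable (fun x : EuclideanSpace ℝ ι => h (WithLp.ofLp x)) :=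
    mp'.integrable_comp_of_integrable hh
  have hR' : Integrable (fun x : EuclideanSpace ℝ ι => R (WithLp.ofLp x)) :=
    mp'.integrable_comp_of_integrable hR
  have := ae_eq_fourierInv_of_fourier_ae_eq hh' hR' (by
    filter_upwards [mp'.quasiMeasurePreserving.ae hhR] with x hx
    rw [← hx, ← WithLp.toLp_ofLp 2 x, fourier_toLp_eq])
  filter_upwards [mp.quasiMeasurePreserving.ae this] with t ht
  have h2 := fourier_toLp_eq (fun x : EuclideanSpace ℝ ι => R (WithLp.ofLp x)) (-t)
  rw [Real.fourierInv_eq_fourier_neg, ← WithLp.toLp_neg, h2] at ht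
  simpa using ht

/-- An integrable function on `ι → ℝ` is determined by its Fourier transform. -/
theorem ae_eq_of_integral_chr_eq {ι : Type*} [Fintype ι] {h k : (ι → ℝ) → ℂ}
    (hh : Integrable h) (hk : Integrable k)
    (hhk : ∀ ξ : ι → ℝ, ∫ t, h t * chr (ξ ⬝ᵥ t) = ∫ t, k t * chr (ξ ⬝ᵥ t)) :
    h =ᵐ[volume] k := by
  have hmul : ∀ {u : (ι → ℝ) → ℂ} (ξ : ι → ℝ), Integrable u →
      Integrable (fun t => u t * chr (ξ ⬝ᵥ t)) := by
    intro u ξ hu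
    refine hu.mul_bdd (c := 1) ?_ (by simp)
    exact Continuous.aestronglyMeasurable (by fun_prop)
  have := ae_eq_integral_of_integral_chr_ae_eq (hh.sub hk) (R := fun _ => 0)
    (integrable_zero _ _ _) (by
      refine Filter.Eventually.of_forall fun ξ => ?_
      simp only [Pi.sub_apply, sub_mul]
      rw [integral_sub (hmul ξ hh) (hmul ξ hk), hhk, sub_self])
  filter_upwards [this] with t ht
  simpa [sub_eq_zero] using ht

/-! ### Entire functions of order two -/

/-- Phragmén–Lindelöf principle in the first quadrant for functions of order two with vanishing
growth along the imaginary axis. -/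
theorem norm_le_of_quadrant {ψ : ℂ → ℂ} (hψ : Differentiable ℂ ψ) {B C : ℝ} (hB : 0 < B)
    (hC : 0 ≤ C) (hgrow : ∀ z : ℂ, ‖ψ z‖ ≤ C * Real.exp (B * z.re ^ 2))
    (hreal : ∀ x : ℝ, ‖ψ x‖ ≤ C) {z : ℂ} (hre : 0 ≤ z.re) (him : 0 ≤ z.im) : ‖ψ z‖ ≤ C := by
  have hexpn : ∀ (δ : ℝ) (w : ℂ), ‖Complex.exp (δ * Complex.I * w ^ 2)‖
      = Real.exp (-(2 * δ * w.re * w.im)) := by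
    intro δ w
    rw [Complex.norm_exp]
    congr 1
    simp [pow_two]; ring
  -- the damped function is bounded on the whole quadrant
  have damped : ∀ δ : ℝ, 0 < δ → ∀ z : ℂ, 0 < z.re → 0 ≤ z.im →
      ‖ψ z * Complex.exp (δ * Complex.I * z ^ 2)‖ ≤ C := by
    intro δ hδ z hre him
    -- Above the ray B Re w = 2δ Im w the damping factor beats the growth. What is left is a sector
    -- of opening φ₀ = arctan (B / 2δ) < π/2.
    have hbig : ∀ w : ℂ, 0 ≤ w.re → B * w.re ≤ 2 * δ * w.im →
        ‖ψ w * Complex.exp (δ * Complex.I * w ^ 2)‖ ≤ C := by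
      intro w hw hw'
      rw [norm_mul, hexpn]
      calc ‖ψ w‖ * Real.exp (-(2 * δ * w.re * w.im))
          ≤ C * Real.exp (B * w.re ^ 2) * Real.exp (-(2 * δ * w.re * w.im)) := by
            gcongr; exact hgrow w
        _ = C * Real.exp (w.re * (B * w.re - 2 * δ * w.im)) := by
            rw [mul_assoc, ← Real.exp_add]; ring_nf
        _ ≤ C * 1 := by
            gcongr
            rw [Real.exp_le_one_iff]
            exact mul_nonpos_of_nonneg_of_nonpos hw (by linarith)
        _ = C := mul_one C
    by_cases hcase : B * z.re ≤ 2 * δ * z.im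
    · exact hbig z hre.le hcase
    push Not at hcase
    set φ₀ := Real.arctan (B / (2 * δ)) with hφ₀
    have hφpos : 0 < φ₀ := Real.arctan_pos.2 (by positivity)
    have hφlt : φ₀ < Real.pi / 2 := Real.arctan_lt_pi_div_two _
    have hz0 : z ≠ 0 := by rintro rfl; simp at hre
    have harg0 : 0 ≤ (Complex.log z).im := by
      rw [Complex.log_im]; exact Complex.arg_nonneg_iff.2 him
    have harg1 : (Complex.log z).im ≤ φ₀ := by
      have hlt := abs_lt.1 (Complex.abs_arg_lt_pi_div_two_iff.2 (Or.inl hre))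
      rw [Complex.log_im, ← Real.arctan_tan hlt.1 hlt.2, Complex.tan_arg, hφ₀]
      apply Real.arctan_strictMono.monotone
      rw [div_le_div_iff₀ hre (by positivity)]
      linarith
    have hd : Differentiable ℂ fun w : ℂ =>
        ψ (Complex.exp w) * Complex.exp (δ * Complex.I * (Complex.exp w) ^ 2) := by fun_prop
    -- The logarithm maps the sector to a strip of width φ₀ and order-two growth to exp (B e^(2|Re
    -- w|)). The exponent 2 is admissible because 2 < π/φ₀.
    have := PhragmenLindelof.horizontal_strip (a := 0) (b := φ₀) (C := C) (z := Complex.log z)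
      (f := fun w : ℂ => ψ (Complex.exp w) * Complex.exp (δ * Complex.I * (Complex.exp w) ^ 2))
      hd.diffContOnCl ?_ ?_ ?_ harg0 harg1
    · simpa [Complex.exp_log hz0] using this
    · refine ⟨2, ?_, B, ?_⟩
      · rw [sub_zero, lt_div_iff₀ hφpos]; linarith
      · refine Asymptotics.IsBigO.of_bound C ?_
        rw [eventually_inf_principal]
        refine Eventually.of_forall fun w hw => ?_
        have hw0 : 0 < w.im := hw.1
        have hw1 : w.im < φ₀ := hw.2
        rw [norm_mul, hexpn, Real.norm_of_nonneg (Real.exp_nonneg _)]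
        have hsin : 0 ≤ (Complex.exp w).im := by
          rw [Complex.exp_im]
          exact mul_nonneg (Real.exp_nonneg _) (Real.sin_nonneg_of_nonneg_of_le_pi hw0.le
            (by linarith))
        have hcos : 0 ≤ (Complex.exp w).re := by
          rw [Complex.exp_re]
          exact mul_nonneg (Real.exp_nonneg _) (Real.cos_nonneg_of_neg_pi_div_two_le_of_le
            (by linarith) (by linarith))
        have hsq : (Complex.exp w).re ^ 2 ≤ Real.exp (2 * |w.re|) := by
          have h1 : (Complex.exp w).re ≤ Real.exp |w.re| :=
            (Complex.re_le_norm _).trans (by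
              rw [Complex.norm_exp]; exact Real.exp_le_exp.2 (le_abs_self _))
          calc (Complex.exp w).re ^ 2 ≤ Real.exp |w.re| ^ 2 := by gcongr
            _ = Real.exp (2 * |w.re|) := by rw [← Real.exp_nat_mul]; norm_num
        calc ‖ψ (Complex.exp w)‖ * Real.exp (-(2 * δ * (Complex.exp w).re * (Complex.exp w).im))
            ≤ (C * Real.exp (B * (Complex.exp w).re ^ 2)) * 1 := by
              gcongr
              · exact hgrow _
              · rw [Real.exp_le_one_iff, neg_nonpos]; positivity
          _ ≤ C * Real.exp (B * Real.exp (2 * |w.re|)) := by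
              rw [mul_one]; gcongr
    · intro w hw
      have h1 : Complex.exp w = (Real.exp w.re : ℝ) := by
        apply Complex.ext
        · rw [Complex.exp_re, hw]; simp [Complex.exp_ofReal_re]
        · rw [Complex.exp_im, hw]; simp [Complex.exp_ofReal_im]
      rw [norm_mul, hexpn, h1]
      simpa using hreal (Real.exp w.re)
    · intro w hw
      apply hbig
      · rw [Complex.exp_re, hw]
        exact mul_nonneg (Real.exp_nonneg _) (Real.cos_arctan_pos _).le
      · rw [Complex.exp_re, Complex.exp_im, hw]
        have hc := Real.cos_arctan_pos (B / (2 * δ))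
        have ht : Real.sin φ₀ = B / (2 * δ) * Real.cos φ₀ := by
          rw [← Real.tan_mul_cos hc.ne', Real.tan_arctan]
        rw [ht]
        apply le_of_eq
        field_simp
  -- The damped bound needs Re z > 0; on the imaginary axis the growth hypothesis is already the
  -- claim.
  rcases hre.eq_or_lt with h0 | hpos
  · have := hgrow z
    rw [← h0] at this
    simpa using this
  · have hlim : Tendsto (fun δ : ℝ => ‖ψ z * Complex.exp (δ * Complex.I * z ^ 2)‖) (𝓝[>] 0)
        (𝓝 ‖ψ z‖) := by
      have hc : Continuous (fun δ : ℝ => ‖ψ z * Complex.exp (δ * Complex.I * z ^ 2)‖) := by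
        fun_prop
      have := (hc.tendsto 0).mono_left (nhdsWithin_le_nhds (s := Set.Ioi 0))
      simpa using this
    refine le_of_tendsto hlim ?_
    filter_upwards [self_mem_nhdsWithin] with δ hδ
    exact damped δ hδ z hpos him

/-- The complex-analytic core of Hardy's uncertainty principle. -/
theorem eq_gaussian_of_entire_bounds {φ : ℂ → ℂ} (hφ : Differentiable ℂ φ) {B C : ℝ} (hB : 0 < B)
    (hgrow : ∀ z : ℂ, ‖φ z‖ ≤ C * Real.exp (B * z.im ^ 2))
    (hreal : ∀ x : ℝ, ‖φ x‖ ≤ C * Real.exp (-B * x ^ 2)) (z : ℂ) :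
    φ z = φ 0 * Complex.exp (-B * z ^ 2) := by
  have hC : 0 ≤ C := by simpa using (norm_nonneg _).trans (hgrow 0)
  -- This factor exchanges the hypotheses: ψ is bounded on the real line, and its growth now depends
  -- on Re z, so it is bounded on the imaginary axis too.
  set ψ : ℂ → ℂ := fun z => φ z * Complex.exp (B * z ^ 2) with hψdef
  have hexpn : ∀ w : ℂ, ‖Complex.exp (B * w ^ 2)‖ = Real.exp (B * w.re ^ 2 - B * w.im ^ 2) := by
    intro w
    rw [Complex.norm_exp]
    congr 1
    simp [pow_two]; ring
  have hψ : Differentiable ℂ ψ := by fun_prop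
  have hg : ∀ z : ℂ, ‖ψ z‖ ≤ C * Real.exp (B * z.re ^ 2) := by
    intro z
    rw [hψdef, norm_mul, hexpn]
    calc _ ≤ C * Real.exp (B * z.im ^ 2) * Real.exp (B * z.re ^ 2 - B * z.im ^ 2) := by
          gcongr; exact hgrow z
      _ = _ := by rw [mul_assoc, ← Real.exp_add]; ring_nf
  have hr : ∀ x : ℝ, ‖ψ x‖ ≤ C := by
    intro x
    rw [hψdef, norm_mul, hexpn]
    calc _ ≤ C * Real.exp (-B * x ^ 2) * Real.exp (B * (x : ℂ).re ^ 2 - B * (x : ℂ).im ^ 2) := by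
          gcongr; exact hreal x
      _ = C := by rw [mul_assoc, ← Real.exp_add]; simp
  have up : ∀ {ψ : ℂ → ℂ}, Differentiable ℂ ψ → (∀ z : ℂ, ‖ψ z‖ ≤ C * Real.exp (B * z.re ^ 2)) →
      (∀ x : ℝ, ‖ψ x‖ ≤ C) → ∀ z : ℂ, 0 ≤ z.re → ‖ψ z‖ ≤ C := by
    intro ψ hψ hg hr z hz
    rcases le_total 0 z.im with h | h
    · exact norm_le_of_quadrant hψ hB hC hg hr hz h
    · have hd : Differentiable ℂ (fun w => star (ψ (star w))) := by
        intro w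
        have := (hψ (star w)).star_star
        simpa [Function.comp_def] using this
      have := norm_le_of_quadrant (ψ := fun w => star (ψ (star w))) hd hB hC
        (fun w => by simpa using hg (star w)) (fun x => by simpa using hr x) (z := star z)
        (by simpa using hz) (by simpa using h)
      simpa using this
  have all : ∀ z : ℂ, ‖ψ z‖ ≤ C := by
    intro z
    rcases le_total 0 z.re with h | h
    · exact up hψ hg hr z h
    · have := up (ψ := fun w => ψ (-w)) (by fun_prop) (fun w => by simpa using hg (-w))
        (fun x => by simpa using hr (-x)) (-z) (by simpa using h)
      simpa using this
  have hconst := hψ.apply_eq_apply_of_bounded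
    (isBounded_iff_forall_norm_le.2 ⟨C, by rintro _ ⟨w, rfl⟩; exact all w⟩) z 0
  simp only [hψdef] at hconst
  have h2 : Complex.exp (B * z ^ 2) * Complex.exp (-B * z ^ 2) = 1 := by
    rw [← Complex.exp_add]; simp
  calc φ z = φ z * (Complex.exp (B * z ^ 2) * Complex.exp (-B * z ^ 2)) := by rw [h2, mul_one]
    _ = _ := by rw [← mul_assoc, hconst]; simp

/-! ### Fourier transforms of functions with Gaussian decay -/

theorem integrable_gaussian_pi {ι : Type*} [Fintype ι] {k : ℝ} (hk : 0 < k) :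
    Integrable (fun p : ι → ℝ => Real.exp (-k * ∑ i, p i ^ 2)) := by
  have := (GaussianFourier.integrable_cexp_neg_mul_sum_add (b := (k : ℂ)) (ι := ι) (by simpa using hk) 0).norm
  refine this.congr (Eventually.of_forall fun p => ?_)
  simp [Complex.norm_exp, ← Complex.ofReal_pow, ← Complex.ofReal_sum]

section Line

variable {ι : Type*} [Fintype ι] {k : (ι → ℝ) → ℂ} {a C : ℝ}

theorem integrable_of_gaussian_bound (ha : 0 < a) (hk : AEStronglyMeasurable k)
    (hbd : ∀ᵐ p, ‖k p‖ ≤ C * Real.exp (-Real.pi * a * ∑ i, p i ^ 2)) : Integrable k := by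
  refine Integrable.mono' ((integrable_gaussian_pi (ι := ι) (k := Real.pi * a)
    (by positivity)).const_mul C) hk ?_
  simpa only [neg_mul] using hbd

theorem gaussian_bound_mul_chr (η : ι → ℝ)
    (hbd : ∀ᵐ p, ‖k p‖ ≤ C * Real.exp (-Real.pi * a * ∑ i, p i ^ 2)) :
    ∀ᵐ p, ‖k p * chr (η ⬝ᵥ p)‖ ≤ C * Real.exp (-Real.pi * a * ∑ i, p i ^ 2) := by
  simpa using hbd

theorem norm_cexp_line (r : ℝ) (ζ : ℂ) :
    ‖Complex.exp (-2 * Real.pi * Complex.I * r * ζ)‖ = Real.exp (2 * Real.pi * r * ζ.im) := by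
  rw [Complex.norm_exp]; congr 1; simp

theorem sq_le_sum_sq (p : ι → ℝ) (j : ι) : p j ^ 2 ≤ ∑ i, p i ^ 2 :=
  Finset.single_le_sum (f := fun i => p i ^ 2) (fun _ _ => sq_nonneg _) (Finset.mem_univ j)

/-- The Fourier transform of a function with Gaussian decay is entire in each coordinate. -/
theorem differentiable_fourier_line (ha : 0 < a) (hk : AEStronglyMeasurable k)
    (hbd : ∀ᵐ p, ‖k p‖ ≤ C * Real.exp (-Real.pi * a * ∑ i, p i ^ 2)) (j : ι) :
    Differentiable ℂ fun ζ : ℂ =>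
      ∫ p, k p * Complex.exp (-2 * Real.pi * Complex.I * (p j : ℝ) * ζ) := by
  intro ζ₀
  -- The first term bounds the exponential rate on the unit ball around ζ₀; the extra 1 pays for |r|
  -- + 1 ≤ e^|r|, the factor produced by differentiation.
  set M : ℝ := 2 * Real.pi * (‖ζ₀‖ + 1) + 1 with hM
  have hbnd : ∀ r : ℝ, |r| * M ≤ M ^ 2 / (2 * Real.pi * a) + Real.pi * a * r ^ 2 / 2 := by
    intro r
    have hpa : 0 < Real.pi * a := by positivity
    have h0 : 0 ≤ (M - Real.pi * a * |r|) ^ 2 / (2 * Real.pi * a) := by positivity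
    have h1 : (M - Real.pi * a * |r|) ^ 2 / (2 * Real.pi * a)
        = M ^ 2 / (2 * Real.pi * a) - |r| * M + Real.pi * a * r ^ 2 / 2 := by
      rw [← sq_abs r]; field_simp; ring
    linarith
  have hexp : ∀ (r : ℝ) (ζ : ℂ), ζ ∈ Metric.ball ζ₀ 1 →
      (|r| + 1) * Real.exp (2 * Real.pi * r * ζ.im) ≤
      Real.exp (M ^ 2 / (2 * Real.pi * a)) * Real.exp (Real.pi * a * r ^ 2 / 2) := by
    intro r ζ hζ
    have hn : ‖ζ‖ ≤ ‖ζ₀‖ + 1 := by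
      have := norm_le_norm_add_norm_sub' ζ ζ₀
      rw [Metric.mem_ball, dist_eq_norm] at hζ
      linarith
    have h1 : r * ζ.im ≤ |r| * (‖ζ₀‖ + 1) :=
      calc r * ζ.im ≤ |r * ζ.im| := le_abs_self _
        _ = |r| * |ζ.im| := abs_mul _ _
        _ ≤ |r| * (‖ζ₀‖ + 1) := by
          gcongr; exact (Complex.abs_im_le_norm ζ).trans hn
    calc (|r| + 1) * Real.exp (2 * Real.pi * r * ζ.im)
        ≤ Real.exp |r| * Real.exp (2 * Real.pi * (|r| * (‖ζ₀‖ + 1))) := by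
          refine mul_le_mul (Real.add_one_le_exp _) (Real.exp_le_exp.2 ?_) (Real.exp_nonneg _)
            (Real.exp_nonneg _)
          rw [mul_assoc]
          exact mul_le_mul_of_nonneg_left h1 (by positivity)
      _ = Real.exp (|r| * M) := by rw [← Real.exp_add, hM]; ring_nf
      _ ≤ _ := by rw [← Real.exp_add]; exact Real.exp_le_exp.2 (hbnd r)
  have hdom : ∀ (p : ι → ℝ) (ζ : ℂ), ζ ∈ Metric.ball ζ₀ 1 →
      ‖k p‖ ≤ C * Real.exp (-Real.pi * a * ∑ i, p i ^ 2) →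
      ‖k p‖ * ((|p j| + 1) * Real.exp (2 * Real.pi * p j * ζ.im)) ≤
      C * Real.exp (M ^ 2 / (2 * Real.pi * a)) *
        Real.exp (-(Real.pi * a / 2) * ∑ i, p i ^ 2) := by
    intro p ζ hζ hp
    have hC : 0 ≤ C := by
      have := (norm_nonneg _).trans hp
      exact nonneg_of_mul_nonneg_left this (Real.exp_pos _)
    calc _ ≤ (C * Real.exp (-Real.pi * a * ∑ i, p i ^ 2)) *
          (Real.exp (M ^ 2 / (2 * Real.pi * a)) * Real.exp (Real.pi * a * (∑ i, p i ^ 2) / 2)) := by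
          refine mul_le_mul hp ?_ (by positivity) ((norm_nonneg _).trans hp)
          refine (hexp (p j) ζ hζ).trans ?_
          gcongr
          exact sq_le_sum_sq p j
      _ = C * Real.exp (M ^ 2 / (2 * Real.pi * a)) * (Real.exp (-Real.pi * a * ∑ i, p i ^ 2) *
          Real.exp (Real.pi * a * (∑ i, p i ^ 2) / 2)) := by ring
      _ = _ := by rw [← Real.exp_add]; ring_nf
  have hball : Metric.ball ζ₀ 1 ∈ 𝓝 ζ₀ := Metric.ball_mem_nhds _ one_pos
  have hmeas : ∀ ζ : ℂ, AEStronglyMeasurable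
      (fun p : ι → ℝ => k p * Complex.exp (-2 * Real.pi * Complex.I * (p j : ℝ) * ζ)) := fun ζ =>
    hk.mul (Continuous.aestronglyMeasurable (by fun_prop))
  have hbint : Integrable (fun p : ι → ℝ => C * Real.exp (M ^ 2 / (2 * Real.pi * a)) *
        Real.exp (-(Real.pi * a / 2) * ∑ i, p i ^ 2)) :=
    (integrable_gaussian_pi (by positivity)).const_mul _
  have hF0 : Integrable
      (fun p : ι → ℝ => k p * Complex.exp (-2 * Real.pi * Complex.I * (p j : ℝ) * ζ₀)) := by
    refine Integrable.mono' hbint (hmeas ζ₀) ?_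
    filter_upwards [hbd] with p hp
    rw [norm_mul, norm_cexp_line]
    refine le_trans ?_ (hdom p ζ₀ (Metric.mem_ball_self one_pos) hp)
    gcongr
    exact le_mul_of_one_le_left (Real.exp_nonneg _) (by linarith [abs_nonneg (p j)])
  have := (hasDerivAt_integral_of_dominated_loc_of_deriv_le (μ := (volume : Measure (ι → ℝ)))
    (F := fun (ζ : ℂ) (p : ι → ℝ) =>
      k p * Complex.exp (-2 * Real.pi * Complex.I * (p j : ℝ) * ζ))
    (F' := fun (ζ : ℂ) (p : ι → ℝ) =>
      k p * (Complex.exp (-2 * Real.pi * Complex.I * (p j : ℝ) * ζ) *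
        (-2 * Real.pi * Complex.I * (p j : ℝ))))
    (bound := fun p => 2 * Real.pi * (C * Real.exp (M ^ 2 / (2 * Real.pi * a)) *
        Real.exp (-(Real.pi * a / 2) * ∑ i, p i ^ 2)))
    hball (Eventually.of_forall hmeas) hF0
    (hk.mul (Continuous.aestronglyMeasurable (by fun_prop))) ?_ (hbint.const_mul _) ?_).2
  · exact this.differentiableAt
  · filter_upwards [hbd] with p hp ζ hζ
    rw [norm_mul, norm_mul, norm_cexp_line]
    have hn : ‖(-2 * Real.pi * Complex.I * (p j : ℝ) : ℂ)‖ = 2 * Real.pi * |p j| := by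
      simp [abs_of_pos Real.pi_pos]
    rw [hn]
    calc _ = 2 * Real.pi * (‖k p‖ * (|p j| * Real.exp (2 * Real.pi * p j * ζ.im))) := by ring
      _ ≤ 2 * Real.pi * (‖k p‖ * ((|p j| + 1) * Real.exp (2 * Real.pi * p j * ζ.im))) := by
        gcongr; linarith
      _ ≤ _ := mul_le_mul_of_nonneg_left (hdom p ζ hζ hp) (by positivity)
  · refine Eventually.of_forall fun p ζ _ => ?_
    have h1 : HasDerivAt (fun ζ : ℂ => -2 * Real.pi * Complex.I * (p j : ℝ) * ζ)
        (-2 * Real.pi * Complex.I * (p j : ℝ)) ζ := by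
      simpa using (hasDerivAt_id ζ).const_mul (-2 * Real.pi * Complex.I * (p j : ℝ) : ℂ)
    exact h1.cexp.const_mul (k p)

/-- Completing the square in p j turns the integrand's bound into exp((π/a) (Im ζ)²) times a
Gaussian centred at Im ζ / a, and translation invariance removes the centre. -/
theorem norm_fourier_line_le [DecidableEq ι] (ha : 0 < a)
    (hbd : ∀ᵐ p, ‖k p‖ ≤ C * Real.exp (-Real.pi * a * ∑ i, p i ^ 2)) (j : ι) (ζ : ℂ) :
    ‖∫ p, k p * Complex.exp (-2 * Real.pi * Complex.I * (p j : ℝ) * ζ)‖ ≤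
      (C * ∫ p : ι → ℝ, Real.exp (-(Real.pi * a) * ∑ i, p i ^ 2)) *
        Real.exp (Real.pi / a * ζ.im ^ 2) := by
  have hg := integrable_gaussian_pi (ι := ι) (k := Real.pi * a) (by positivity)
  set w : ι → ℝ := Pi.single j (ζ.im / a)
  have hsq : ∀ p : ι → ℝ, Real.exp (-Real.pi * a * ∑ i, p i ^ 2) *
      Real.exp (2 * Real.pi * p j * ζ.im) =
      Real.exp (Real.pi / a * ζ.im ^ 2) *
        Real.exp (-(Real.pi * a) * ∑ i, (p - w) i ^ 2) := by
    intro p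
    have h1 : ∑ i, (p - w) i ^ 2 = ∑ i, p i ^ 2 - 2 * p j * (ζ.im / a) + (ζ.im / a) ^ 2 := by
      have h2 : ∀ i, (p - w) i ^ 2 = p i ^ 2 - 2 * p i * w i + w i * w i := by
        intro i; simp only [Pi.sub_apply]; ring
      simp only [h2, Finset.sum_add_distrib, Finset.sum_sub_distrib]
      simp [w, Pi.single_apply]
      ring
    rw [← Real.exp_add, ← Real.exp_add, h1]
    congr 1
    field_simp
    ring
  calc _ ≤ ∫ p : ι → ℝ, Real.exp (Real.pi / a * ζ.im ^ 2) * (C *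
        Real.exp (-(Real.pi * a) * ∑ i, (p - w) i ^ 2)) := by
        refine norm_integral_le_of_norm_le (((hg.comp_sub_right w).const_mul C).const_mul _) ?_
        filter_upwards [hbd] with p hp
        rw [norm_mul, norm_cexp_line]
        calc _ ≤ C * Real.exp (-Real.pi * a * ∑ i, p i ^ 2) *
              Real.exp (2 * Real.pi * p j * ζ.im) := by gcongr
          _ = _ := by rw [mul_assoc, hsq]; ring
    _ = _ := by
        rw [integral_const_mul, integral_const_mul]
        rw [integral_sub_right_eq_self (fun p : ι → ℝ =>
          Real.exp (-(Real.pi * a) * ∑ i, p i ^ 2)) w]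
        ring

end Line

/-! ### Hardy's theorem in several variables -/

section Hardy

variable {ι : Type*} [Fintype ι] [DecidableEq ι] {h : (ι → ℝ) → ℂ} {a b C D : ℝ} {s : ι → ℝ}

/-- Hardy's theorem in one coordinate: the transform is Gaussian in every coordinate where the
decay rates are critical or beyond. -/
theorem fourier_eq_update_mul_gaussian (ha : 0 < a) (hb : 0 < b) (hh : AEStronglyMeasurable h)
    (hbd : ∀ᵐ p, ‖h p‖ ≤ C * Real.exp (-Real.pi * a * ∑ i, p i ^ 2))
    (hft : ∀ η : ι → ℝ, ‖∫ p, h p * chr (η ⬝ᵥ p)‖ ≤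
      D * Real.exp (-Real.pi * b * ∑ i, s i ^ 2 * η i ^ 2))
    (j : ι) (hj : 1 ≤ a * b * s j ^ 2) (η : ι → ℝ) :
    ∫ p, h p * chr (η ⬝ᵥ p) = (∫ p, h p * chr (Function.update η j 0 ⬝ᵥ p)) *
      Complex.exp (-(Real.pi / a : ℝ) * (η j : ℂ) ^ 2) := by
  -- Freezing the other frequencies only modulates h, so its Gaussian bound survives and the
  -- transform becomes a function of one complex variable.
  set η₀ := Function.update η j 0 with hη₀
  set k : (ι → ℝ) → ℂ := fun p => h p * chr (η₀ ⬝ᵥ p) with hk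
  have hkm : AEStronglyMeasurable k :=
    hh.mul (Continuous.aestronglyMeasurable (by fun_prop))
  have hkb := gaussian_bound_mul_chr η₀ hbd
  have hline : ∀ x : ℝ, ∫ p, k p * Complex.exp (-2 * Real.pi * Complex.I * (p j : ℝ) * x) =
      ∫ p, h p * chr (Function.update η j x ⬝ᵥ p) := by
    intro x
    congr 1 with p
    have h1 : Function.update η j x = η₀ + Pi.single j x := by
      ext i
      by_cases hi : i = j
      · subst hi; simp [hη₀]
      · simp [hη₀, hi]
    rw [h1, add_dotProduct, chr_add, single_dotProduct, hk, mul_assoc]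
    congr 2
    simp only [chr]; congr 1; push_cast; ring
  have hD : 0 ≤ D := by
    have := (norm_nonneg _).trans (hft 0)
    exact nonneg_of_mul_nonneg_left this (Real.exp_pos _)
  set C₁ := C * ∫ p : ι → ℝ, Real.exp (-(Real.pi * a) * ∑ i, p i ^ 2)
  -- B = π/a is dictated by the growth; `hj` says that the real decay rate π b s_j² is at least B.
  have key := eq_gaussian_of_entire_bounds (φ := fun ζ : ℂ =>
      ∫ p, k p * Complex.exp (-2 * Real.pi * Complex.I * (p j : ℝ) * ζ)) (B := Real.pi / a)
      (C := max C₁ D) (differentiable_fourier_line ha hkm hkb j) (by positivity) ?_ ?_ (η j)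
  · rw [hline, Function.update_eq_self] at key
    rw [key]
    simp
  · intro z
    refine (norm_fourier_line_le ha hkb j z).trans ?_
    gcongr
    exact le_max_left _ _
  · intro x
    rw [hline]
    refine (hft _).trans ?_
    have h2 : Real.pi / a * x ^ 2 ≤
        Real.pi * b * ∑ i, s i ^ 2 * Function.update η j x i ^ 2 := by
      have h3 : s j ^ 2 * x ^ 2 ≤ ∑ i, s i ^ 2 * Function.update η j x i ^ 2 := by
        have := Finset.single_le_sum (f := fun i => s i ^ 2 * Function.update η j x i ^ 2)
          (fun i _ => by positivity) (Finset.mem_univ j)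
        simpa using this
      calc Real.pi / a * x ^ 2 ≤ Real.pi / a * x ^ 2 * (a * b * s j ^ 2) :=
            le_mul_of_one_le_right (by positivity) hj
        _ = Real.pi * b * (s j ^ 2 * x ^ 2) := by field_simp
        _ ≤ _ := by gcongr
    calc _ ≤ D * Real.exp (-(Real.pi / a) * x ^ 2) := by
          gcongr D * Real.exp ?_; linarith
      _ ≤ _ := by gcongr; exact le_max_right _ _

/-- Hardy's theorem beyond the critical rates in some coordinate. -/
theorem ae_eq_zero_of_hardy (ha : 0 < a) (hb : 0 < b) (hh : AEStronglyMeasurable h)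
    (hbd : ∀ᵐ p, ‖h p‖ ≤ C * Real.exp (-Real.pi * a * ∑ i, p i ^ 2))
    (hft : ∀ η : ι → ℝ, ‖∫ p, h p * chr (η ⬝ᵥ p)‖ ≤
      D * Real.exp (-Real.pi * b * ∑ i, s i ^ 2 * η i ^ 2))
    (j : ι) (hj : 1 < a * b * s j ^ 2) : h =ᵐ[volume] 0 := by
  have hD : 0 ≤ D := by
    have := (norm_nonneg _).trans (hft 0)
    exact nonneg_of_mul_nonneg_left this (Real.exp_pos _)
  have hzero : ∀ η : ι → ℝ, ∫ p, h p * chr (η ⬝ᵥ p) = 0 := by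
    intro η
    rw [fourier_eq_update_mul_gaussian ha hb hh hbd hft j hj.le η]
    suffices hsuff : ∫ p, h p * chr (Function.update η j 0 ⬝ᵥ p) = 0 by rw [hsuff, zero_mul]
    set L := ∫ p, h p * chr (Function.update η j 0 ⬝ᵥ p) with hL
    -- q = π b s_j² - π/a is the surplus of the assumed decay over that of the Gaussian factor;
    -- letting the j-th frequency tend to infinity forces L = 0.
    set q := Real.pi / a * (a * b * s j ^ 2 - 1) with hq
    have hqpos : 0 < q := mul_pos (by positivity) (by linarith)
    have hx : ∀ x : ℝ, ‖L‖ ≤ D * Real.exp (-(q * x ^ 2)) := by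
      intro x
      have h1 := fourier_eq_update_mul_gaussian ha hb hh hbd hft j hj.le (Function.update η j x)
      rw [Function.update_idem, ← hL, Function.update_self] at h1
      have h2 := hft (Function.update η j x)
      rw [h1, norm_mul] at h2
      have h3 : ‖Complex.exp (-(Real.pi / a : ℝ) * (x : ℂ) ^ 2)‖
          = Real.exp (-(Real.pi / a * x ^ 2)) := by
        rw [Complex.norm_exp]; congr 1
        simp [← Complex.ofReal_pow]
      rw [h3] at h2
      have h4 : s j ^ 2 * x ^ 2 ≤ ∑ i, s i ^ 2 * Function.update η j x i ^ 2 := by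
        have := Finset.single_le_sum (f := fun i => s i ^ 2 * Function.update η j x i ^ 2)
          (fun i _ => by positivity) (Finset.mem_univ j)
        simpa using this
      calc ‖L‖ = ‖L‖ * Real.exp (-(Real.pi / a * x ^ 2)) * Real.exp (Real.pi / a * x ^ 2) := by
            rw [mul_assoc, ← Real.exp_add]; simp
        _ ≤ D * Real.exp (-Real.pi * b * (s j ^ 2 * x ^ 2)) *
            Real.exp (Real.pi / a * x ^ 2) := by
            refine mul_le_mul_of_nonneg_right (h2.trans ?_) (Real.exp_nonneg _)
            gcongr D * Real.exp ?_
            have : Real.pi * b * (s j ^ 2 * x ^ 2) ≤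
              Real.pi * b * ∑ i, s i ^ 2 * Function.update η j x i ^ 2 := by gcongr
            linarith
        _ = _ := by
            rw [mul_assoc, ← Real.exp_add, hq]; congr 2; field_simp; ring
    have hlim : Tendsto (fun x : ℝ => D * Real.exp (-(q * x ^ 2))) atTop (𝓝 (D * 0)) := by
      refine Tendsto.const_mul D ?_
      refine Real.tendsto_exp_neg_atTop_nhds_zero.comp ?_
      exact (tendsto_pow_atTop two_ne_zero).const_mul_atTop hqpos
    have := ge_of_tendsto' hlim hx
    rw [mul_zero] at this
    exact norm_le_zero_iff.1 this
  have hi := integrable_of_gaussian_bound ha hh hbd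
  exact ae_eq_of_integral_chr_eq hi (integrable_zero _ _ _) fun ξ => by simp [hzero]

/-- Hardy's theorem at the critical rates. -/
theorem ae_eq_gaussian_of_hardy (ha : 0 < a) (hb : 0 < b) (hh : AEStronglyMeasurable h)
    (hbd : ∀ᵐ p, ‖h p‖ ≤ C * Real.exp (-Real.pi * a * ∑ i, p i ^ 2))
    (hft : ∀ η : ι → ℝ, ‖∫ p, h p * chr (η ⬝ᵥ p)‖ ≤
      D * Real.exp (-Real.pi * b * ∑ i, s i ^ 2 * η i ^ 2))
    (hs : ∀ j, a * b * s j ^ 2 = 1) :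
    ∃ L : ℂ, ∀ᵐ p, h p = L * Complex.exp (-(Real.pi * a : ℝ) * ∑ i, (p i : ℂ) ^ 2) := by
  have hprod : ∀ (T : Finset ι) (η : ι → ℝ), ∫ p, h p * chr (η ⬝ᵥ p) =
      (∫ p, h p * chr ((fun i => if i ∈ T then 0 else η i) ⬝ᵥ p)) *
        Complex.exp (-(Real.pi / a : ℝ) * ∑ i ∈ T, (η i : ℂ) ^ 2) := by
    intro T
    induction T using Finset.induction_on with
    | empty => intro η; simp
    | insert j T hj ih =>
      intro η
      rw [ih, fourier_eq_update_mul_gaussian ha hb hh hbd hft j (hs j).ge]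
      have h1 : Function.update (fun i => if i ∈ T then 0 else η i) j 0 =
          fun i => if i ∈ insert j T then 0 else η i := by
        ext i
        by_cases hi : i = j
        · subst hi; simp
        · simp [hi]
      rw [h1, mul_assoc, ← Complex.exp_add, Finset.sum_insert hj, mul_add]
      simp [hj]
  set g : (ι → ℝ) → ℂ := fun p => Complex.exp (-(Real.pi * a : ℝ) * ∑ i, (p i : ℂ) ^ 2)
  have hπa : 0 < Real.pi * a := by positivity
  have hgi : Integrable g := by
    simpa [g] using GaussianFourier.integrable_cexp_neg_mul_sum_add (b := (Real.pi * a : ℝ))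
      (ι := ι) (by simpa using hπa) 0
  -- The transforms of h and of the Gaussian g are now multiples of one function, so uniqueness
  -- applies with L the ratio of their values at 0.
  obtain ⟨N, hN, hgft⟩ : ∃ N : ℂ, N ≠ 0 ∧ ∀ ξ : ι → ℝ, ∫ t, g t * chr (ξ ⬝ᵥ t) =
      N * Complex.exp (-(Real.pi / a : ℝ) * ∑ i, (ξ i : ℂ) ^ 2) := by
    refine ⟨(Real.pi / (Real.pi * a : ℝ)) ^ (Fintype.card ι / 2 : ℂ), ?_, fun ξ => ?_⟩
    · rw [Ne, Complex.cpow_eq_zero_iff, not_and_or]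
      refine Or.inl (div_ne_zero ?_ ?_)
      · exact_mod_cast Real.pi_ne_zero
      · exact_mod_cast hπa.ne'
    · have := GaussianFourier.integral_cexp_neg_mul_sum_add (b := (Real.pi * a : ℝ)) (ι := ι)
        (by simpa using hπa) (fun i => -2 * Real.pi * Complex.I * ξ i)
      refine Eq.trans ?_ (this.trans ?_)
      · congr 1 with t
        simp only [g, chr, ← Complex.exp_add, dotProduct]
        congr 2
        push_cast
        rw [Finset.mul_sum]
        exact Finset.sum_congr rfl fun i _ => by ring
      · congr 2
        simp only [mul_pow, Complex.I_sq, ← Finset.mul_sum]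
        have : (Real.pi : ℂ) ≠ 0 := by exact_mod_cast Real.pi_ne_zero
        have : (a : ℂ) ≠ 0 := by exact_mod_cast ha.ne'
        push_cast
        field_simp
        ring
  set L := (∫ p, h p * chr ((0 : ι → ℝ) ⬝ᵥ p)) / N with hL
  refine ⟨L, ?_⟩
  have hi := integrable_of_gaussian_bound ha hh hbd
  refine ae_eq_of_integral_chr_eq hi (hgi.const_mul L) fun ξ => ?_
  have h2 : ∫ t, L * g t * chr (ξ ⬝ᵥ t) = L * ∫ t, g t * chr (ξ ⬝ᵥ t) := by
    rw [← integral_const_mul]; simp only [mul_assoc]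
  rw [h2, hgft, hprod Finset.univ ξ, ← mul_assoc, hL, div_mul_cancel₀ _ hN]
  simp only [Finset.mem_univ, if_true]
  rfl

end Hardy

/-! ### Midpoint coordinates and the phase-space change of variables -/

section Midpoint

variable {ι : Type*} [Fintype ι]

/-- The coordinates `(m, τ) ↦ (m + τ/2, m - τ/2)` preserve Lebesgue measure. -/
theorem measurePreserving_add_sub_half :
    MeasurePreserving (fun z : (ι → ℝ) × (ι → ℝ) =>
      (z.1 + (1 / 2 : ℝ) • z.2, z.1 - (1 / 2 : ℝ) • z.2)) := by
  have h1 : MeasurePreserving (fun z : (ι → ℝ) × (ι → ℝ) => (z.1, z.1 - z.2)) :=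
    MeasurePreserving.skew_product (g := fun u τ => u - τ) (MeasurePreserving.id volume)
      (by fun_prop) (Eventually.of_forall fun u =>
        (Measure.measurePreserving_sub_left volume u).map_eq)
  have h2 : MeasurePreserving (fun z : (ι → ℝ) × (ι → ℝ) => (z.1, z.2 + (1 / 2 : ℝ) • z.1)) :=
    MeasurePreserving.skew_product (g := fun τ m => m + (1 / 2 : ℝ) • τ)
      (MeasurePreserving.id volume) (by fun_prop) (Eventually.of_forall fun τ =>
        (measurePreserving_add_right volume ((1 / 2 : ℝ) • τ)).map_eq)
  have hsw : MeasurePreserving (Prod.swap : (ι → ℝ) × (ι → ℝ) → (ι → ℝ) × (ι → ℝ)) :=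
    Measure.measurePreserving_swap
  have := h1.comp (hsw.comp (h2.comp hsw))
  convert this using 1
  ext z i
  · simp
  · simp; ring

/-- The inverse coordinates `(u, v) ↦ ((u + v)/2, u - v)` preserve Lebesgue measure. -/
theorem measurePreserving_mid_sub :
    MeasurePreserving (fun z : (ι → ℝ) × (ι → ℝ) =>
      ((1 / 2 : ℝ) • (z.1 + z.2), z.1 - z.2)) := by
  let e : (ι → ℝ) × (ι → ℝ) ≃ᵐ (ι → ℝ) × (ι → ℝ) :=
    { toFun := fun z => (z.1 + (1 / 2 : ℝ) • z.2, z.1 - (1 / 2 : ℝ) • z.2)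
      invFun := fun z => ((1 / 2 : ℝ) • (z.1 + z.2), z.1 - z.2)
      left_inv := fun z => by ext i <;> simp <;> ring
      right_inv := fun z => by ext i <;> simp <;> ring
      measurable_toFun := by dsimp; fun_prop
      measurable_invFun := by dsimp; fun_prop }
  exact MeasurePreserving.symm e measurePreserving_add_sub_half

theorem ae_of_ae_add_sub_half {p : (ι → ℝ) × (ι → ℝ) → Prop}
    (h : ∀ᵐ z : (ι → ℝ) × (ι → ℝ), p (z.1 + (1 / 2 : ℝ) • z.2, z.1 - (1 / 2 : ℝ) • z.2)) :
    ∀ᵐ z, p z := by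
  filter_upwards [measurePreserving_mid_sub.quasiMeasurePreserving.ae h] with z hz
  convert hz using 1
  ext i <;> simp <;> ring

/-- Up to a constant factor, `(ξ, τ) ↦ (w - s ξ + τ/2, w - s ξ - τ/2)` preserves Lebesgue
measure. -/
theorem exists_map_phase_eq_smul {s : ι → ℝ} (hs : ∀ i, s i ≠ 0) :
    ∃ N : ℝ, 0 < N ∧ ∀ w : ι → ℝ, Measure.map (fun z : (ι → ℝ) × (ι → ℝ) =>
      (w - s * z.1 + (1 / 2 : ℝ) • z.2, w - s * z.1 - (1 / 2 : ℝ) • z.2)) volume =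
        ENNReal.ofReal N • volume := by
  classical
  have hdet : (Matrix.diagonal s).det ≠ 0 := by
    rw [Matrix.det_diagonal]; exact Finset.prod_ne_zero_iff.2 fun i _ => hs i
  have hpos : 0 < |(Matrix.diagonal s).det| := abs_pos.2 hdet
  refine ⟨|(Matrix.diagonal s).det|⁻¹, inv_pos.2 hpos, fun w => ?_⟩
  have h1 : Measure.map (fun ξ : ι → ℝ => s * ξ) volume =
      ENNReal.ofReal (|(Matrix.diagonal s).det|⁻¹) • volume := by
    have h2 := Real.smul_map_diagonal_volume_pi hdet
    have h3 : (Matrix.toLin' (Matrix.diagonal s) : (ι → ℝ) → (ι → ℝ)) = fun ξ => s * ξ := by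
      ext ξ i; simp [Matrix.mulVec_diagonal]
    rw [h3] at h2
    conv_rhs => rw [← h2]
    rw [smul_smul, ← ENNReal.ofReal_mul (by positivity), inv_mul_cancel₀ hpos.ne']
    simp
  have h2 : Measure.map (fun ξ : ι → ℝ => w - s * ξ) volume =
      ENNReal.ofReal (|(Matrix.diagonal s).det|⁻¹) • volume := by
    have : (fun ξ : ι → ℝ => w - s * ξ) = (fun ξ => w - ξ) ∘ fun ξ => s * ξ := rfl
    rw [this, ← Measure.map_map (by fun_prop) (by fun_prop), h1, Measure.map_smul,
      (Measure.measurePreserving_sub_left volume w).map_eq]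
  have h3 : Measure.map (Prod.map (fun ξ : ι → ℝ => w - s * ξ) (id : (ι → ℝ) → (ι → ℝ)))
      (volume.prod volume) = ENNReal.ofReal (|(Matrix.diagonal s).det|⁻¹) • volume.prod volume := by
    rw [← Measure.map_prod_map _ _ (by fun_prop) measurable_id, h2, Measure.map_id,
      Measure.prod_smul_left]
  have h4 : (fun z : (ι → ℝ) × (ι → ℝ) =>
      (w - s * z.1 + (1 / 2 : ℝ) • z.2, w - s * z.1 - (1 / 2 : ℝ) • z.2)) =
      (fun z : (ι → ℝ) × (ι → ℝ) => (z.1 + (1 / 2 : ℝ) • z.2, z.1 - (1 / 2 : ℝ) • z.2)) ∘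
        (Prod.map (fun ξ : ι → ℝ => w - s * ξ) (id : (ι → ℝ) → (ι → ℝ))) := rfl
  rw [h4, ← Measure.map_map (by fun_prop) (by fun_prop), Measure.volume_eq_prod, h3,
    Measure.map_smul, ← Measure.volume_eq_prod, measurePreserving_add_sub_half.map_eq]

end Midpoint

/-! ### Wigner distributions of slices -/

section Slices

variable {ι κ : Type*} [Fintype ι]

/-- The cross-Wigner distribution on `ι → ℝ`. -/
noncomputable def wig (F G : (ι → ℝ) → ℂ) (x ξ : ι → ℝ) : ℂ :=
  ∫ t : ι → ℝ, F (x + (1 / 2 : ℝ) • t) * (starRingEnd ℂ) (G (x - (1 / 2 : ℝ) • t)) * chr (ξ ⬝ᵥ t)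

theorem memLp_two_comp_affine {V : Type*} [NormedAddCommGroup V] [NormedSpace ℝ V]
    [MeasurableSpace V] [BorelSpace V] [FiniteDimensional ℝ V] {μ : Measure V}
    [μ.IsAddHaarMeasure] {F : V → ℂ} (hFm : StronglyMeasurable F) (hF : MemLp F 2 μ) (z : V)
    {r : ℝ} (hr : r ≠ 0) : MemLp (fun t => F (z + r • t)) 2 μ := by
  have hm : StronglyMeasurable (fun t => F (z + r • t)) :=
    hFm.comp_measurable (by fun_prop)
  rw [memLp_two_iff_integrable_sq_norm hm.aestronglyMeasurable]
  rw [memLp_two_iff_integrable_sq_norm hFm.aestronglyMeasurable] at hF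
  exact (hF.comp_add_left z).comp_smul hr

theorem integrable_wigner_integrand {V : Type*} [NormedAddCommGroup V] [NormedSpace ℝ V]
    [MeasurableSpace V] [BorelSpace V] [FiniteDimensional ℝ V] {μ : Measure V}
    [μ.IsAddHaarMeasure] {F : V → ℂ} (hFm : StronglyMeasurable F) (hF : MemLp F 2 μ) (z : V) :
    Integrable (fun t => F (z + (1 / 2 : ℝ) • t) *
      (starRingEnd ℂ) (F (z - (1 / 2 : ℝ) • t))) μ := by
  have h1 := memLp_two_comp_affine hFm hF z (r := 1 / 2) (by norm_num)
  have h2 := (memLp_two_comp_affine hFm hF z (r := -(1 / 2)) (by norm_num)).star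
  refine (h1.integrable_mul h2).congr (Eventually.of_forall fun t => ?_)
  simp [sub_eq_add_neg]

/-- Equality of the Wigner distributions on a product, as functions of the momentum in the second
factor, gives equality of the Wigner distributions of slices. -/
theorem wig_slice_ae_eq [Fintype κ] {F G : (ι → ℝ) × (κ → ℝ) → ℂ} (hFm : StronglyMeasurable F)
    (hGm : StronglyMeasurable G) (hF : MemLp F 2) (hG : MemLp G 2) (x ξ x' ξ' : ι → ℝ) (y : κ → ℝ)
    (h : ∀ η : κ → ℝ, ∫ t : (ι → ℝ) × (κ → ℝ),
        G (x + (1 / 2 : ℝ) • t.1, y + (1 / 2 : ℝ) • t.2) *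
          (starRingEnd ℂ) (G (x - (1 / 2 : ℝ) • t.1, y - (1 / 2 : ℝ) • t.2)) *
          chr (ξ ⬝ᵥ t.1 + η ⬝ᵥ t.2) =
      ∫ t : (ι → ℝ) × (κ → ℝ),
        F (x' + (1 / 2 : ℝ) • t.1, y + (1 / 2 : ℝ) • t.2) *
          (starRingEnd ℂ) (F (x' - (1 / 2 : ℝ) • t.1, y - (1 / 2 : ℝ) • t.2)) *
          chr (ξ' ⬝ᵥ t.1 + η ⬝ᵥ t.2)) :
    ∀ᵐ τ : κ → ℝ,
      wig (fun p => G (p, y + (1 / 2 : ℝ) • τ)) (fun p => G (p, y - (1 / 2 : ℝ) • τ)) x ξ =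
      wig (fun p => F (p, y + (1 / 2 : ℝ) • τ)) (fun p => F (p, y - (1 / 2 : ℝ) • τ)) x' ξ' := by
  -- By Fubini, the Wigner integral over the product, as a function of η, is the Fourier transform
  -- in τ of the Wigner distribution of the slices at y ± τ/2.
  have aux : ∀ {H : (ι → ℝ) × (κ → ℝ) → ℂ} (x ξ : ι → ℝ), StronglyMeasurable H → MemLp H 2 →
      Integrable (fun τ : κ → ℝ =>
        wig (fun p => H (p, y + (1 / 2 : ℝ) • τ)) (fun p => H (p, y - (1 / 2 : ℝ) • τ)) x ξ) ∧
      ∀ η : κ → ℝ, ∫ τ : κ → ℝ, wig (fun p => H (p, y + (1 / 2 : ℝ) • τ))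
          (fun p => H (p, y - (1 / 2 : ℝ) • τ)) x ξ * chr (η ⬝ᵥ τ) =
        ∫ t : (ι → ℝ) × (κ → ℝ),
        H (x + (1 / 2 : ℝ) • t.1, y + (1 / 2 : ℝ) • t.2) *
          (starRingEnd ℂ) (H (x - (1 / 2 : ℝ) • t.1, y - (1 / 2 : ℝ) • t.2)) *
          chr (ξ ⬝ᵥ t.1 + η ⬝ᵥ t.2) := by
    intro H x ξ hHm hH
    have hbnd : ∀ η : κ → ℝ, Integrable (fun t : (ι → ℝ) × (κ → ℝ) =>
        H (x + (1 / 2 : ℝ) • t.1, y + (1 / 2 : ℝ) • t.2) *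
          (starRingEnd ℂ) (H (x - (1 / 2 : ℝ) • t.1, y - (1 / 2 : ℝ) • t.2)) *
          chr (ξ ⬝ᵥ t.1 + η ⬝ᵥ t.2)) (volume.prod volume) := by
      intro η
      have : (volume : Measure ((ι → ℝ) × (κ → ℝ))).IsAddHaarMeasure :=
        Measure.prod.instIsAddHaarMeasure volume volume
      refine (integrable_wigner_integrand hHm hH (x, y)).mul_bdd (c := 1)
        (Continuous.aestronglyMeasurable (by fun_prop)) (by simp)
    refine ⟨?_, fun η => ?_⟩
    · have := (hbnd 0).integral_prod_right
      simpa [wig] using this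
    · rw [Measure.volume_eq_prod, integral_prod_symm _ (hbnd η)]
      congr 1 with τ
      rw [wig, ← integral_mul_const]
      congr 1 with t
      rw [chr_add]; ring
  refine ae_eq_of_integral_chr_eq (aux x ξ hGm hG).1 (aux x' ξ' hFm hF).1 fun η => ?_
  rw [(aux x ξ hGm hG).2, (aux x' ξ' hFm hF).2, h]

theorem stronglyMeasurable_wig_slice {F : (ι → ℝ) × (κ → ℝ) → ℂ} (hFm : StronglyMeasurable F)
    {Z : Type*} [MeasurableSpace Z] {X Ξ : Z → ι → ℝ} {Y Y' : Z → κ → ℝ} (hX : Measurable X)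
    (hΞ : Measurable Ξ) (hY : Measurable Y) (hY' : Measurable Y') :
    StronglyMeasurable fun z => wig (fun p => F (p, Y z)) (fun p => F (p, Y' z)) (X z) (Ξ z) := by
  unfold wig
  refine StronglyMeasurable.integral_prod_right' (f := fun q : Z × (ι → ℝ) =>
    F (X q.1 + (1 / 2 : ℝ) • q.2, Y q.1) *
      (starRingEnd ℂ) (F (X q.1 - (1 / 2 : ℝ) • q.2, Y' q.1)) * chr (Ξ q.1 ⬝ᵥ q.2)) ?_
  refine ((hFm.comp_measurable (by fun_prop)).mul
    (RCLike.continuous_conj.comp_stronglyMeasurable (hFm.comp_measurable (by fun_prop)))).mul ?_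
  refine continuous_chr.comp_stronglyMeasurable (Measurable.stronglyMeasurable ?_)
  unfold dotProduct
  fun_prop

end Slices

/-! ### From Wigner covariance to the fractional Fourier kernel -/

section Kernel

variable {ι : Type*} [Fintype ι] {F : (ι → ℝ) → ℂ} {c s : ι → ℝ}

/-- The phase `∑ (u p / s - (c / 2s) (u² + p²))` of the fractional Fourier kernel. -/
noncomputable def fracPhase (c s u p : ι → ℝ) : ℝ :=
  ∑ i, (u i * p i / s i - c i / (2 * s i) * (u i ^ 2 + p i ^ 2))

/-- The unnormalized fractional Fourier integral. -/
noncomputable def fracInt (c s : ι → ℝ) (F : (ι → ℝ) → ℂ) (u : ι → ℝ) : ℂ :=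
  ∫ p, F p * chr (fracPhase c s u p)

theorem continuous_fracPhase (c s : ι → ℝ) :
    Continuous fun z : (ι → ℝ) × (ι → ℝ) => fracPhase c s z.1 z.2 := by
  unfold fracPhase; fun_prop

theorem continuous_fracInt (c s : ι → ℝ) (hF : Integrable F) : Continuous (fracInt c s F) := by
  unfold fracInt
  refine continuous_of_dominated (bound := fun p => ‖F p‖) (fun u => ?_) (fun u => ?_) hF.norm ?_
  · exact hF.aestronglyMeasurable.mul (continuous_chr.comp
      ((continuous_fracPhase c s).comp (by fun_prop : Continuous fun p => (u, p)))).aestronglyMeasurable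
  · simp
  · refine Eventually.of_forall fun p => continuous_const.mul (continuous_chr.comp
      ((continuous_fracPhase c s).comp (by fun_prop : Continuous fun u => (u, p))))

theorem integrable_mul_chr_fracPhase (u : ι → ℝ) (hF : Integrable F) :
    Integrable fun p => F p * chr (fracPhase c s u p) :=
  hF.mul_bdd (c := 1) (continuous_chr.comp
      ((continuous_fracPhase c s).comp (by fun_prop : Continuous fun p => (u, p)))).aestronglyMeasurable
      (by simp)

/-- This is where the kernel emerges: the rotated Wigner phase plus the phase of Fourier inversion
splits into one term for each endpoint of the pair. The identity c² + s² = 1 matches the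
coefficients. -/
theorem fracPhase_sub_fracPhase (hs : ∀ i, s i ≠ 0) (hcs : ∀ i, c i ^ 2 + s i ^ 2 = 1)
    (x t ξ τ : ι → ℝ) :
    (s * x + c * ξ) ⬝ᵥ τ + -(t ⬝ᵥ ξ) =
      fracPhase c s (x + (1 / 2 : ℝ) • t) (c * x - s * ξ + (1 / 2 : ℝ) • τ) +
      -fracPhase c s (x - (1 / 2 : ℝ) • t) (c * x - s * ξ - (1 / 2 : ℝ) • τ) := by
  unfold fracPhase dotProduct
  rw [← Finset.sum_neg_distrib, ← Finset.sum_neg_distrib, ← Finset.sum_add_distrib,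
    ← Finset.sum_add_distrib]
  refine Finset.sum_congr rfl fun i _ => ?_
  have h := hs i
  have h2 : s i ^ 2 = 1 - c i ^ 2 := by linarith [hcs i]
  simp only [Pi.add_apply, Pi.sub_apply, Pi.mul_apply, Pi.smul_apply, smul_eq_mul]
  field_simp
  ring_nf
  rw [h2]
  ring

/-- If the Wigner distribution of `G, G'` is the rotated one of `F, F'`, then `G ⊗ conj G'` is a
multiple of the tensor product of the fractional Fourier integrals of `F` and `F'`. -/
theorem tensor_ae_eq_of_wig_eq (hs : ∀ i, s i ≠ 0) (hcs : ∀ i, c i ^ 2 + s i ^ 2 = 1) :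
    ∃ N : ℝ, 0 < N ∧ ∀ F F' G G' : (ι → ℝ) → ℂ, StronglyMeasurable G → StronglyMeasurable G' →
      Integrable F → Integrable F' → MemLp G 2 → MemLp G' 2 →
      (∀ᵐ z : (ι → ℝ) × (ι → ℝ), wig G G' z.1 z.2 =
        wig F F' (c * z.1 - s * z.2) (s * z.1 + c * z.2)) →
      ∀ᵐ z : (ι → ℝ) × (ι → ℝ), G z.1 * (starRingEnd ℂ) (G' z.2) =
        N * (fracInt c s F z.1 * (starRingEnd ℂ) (fracInt c s F' z.2)) := by
  obtain ⟨N, hN, hmap⟩ := exists_map_phase_eq_smul hs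
  refine ⟨N, hN, fun F F' G G' hGm hGm' hF hF' hG hG' hW => ?_⟩
  apply ae_of_ae_add_sub_half
  rw [Measure.volume_eq_prod, Measure.ae_prod_iff_ae_ae]
  swap
  · refine StronglyMeasurable.measurableSet_eq_fun ?_ ?_
    · exact (hGm.comp_measurable (by fun_prop)).mul
        (RCLike.continuous_conj.comp_stronglyMeasurable (hGm'.comp_measurable (by fun_prop)))
    · refine Continuous.stronglyMeasurable (continuous_const.mul (Continuous.mul ?_ ?_))
      · exact (continuous_fracInt c s hF).comp (by fun_prop)
      · exact RCLike.continuous_conj.comp ((continuous_fracInt c s hF').comp (by fun_prop))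
  filter_upwards [Measure.ae_ae_of_ae_prod hW] with x hx
  have hGG : Integrable (fun t => G (x + (1 / 2 : ℝ) • t) *
      (starRingEnd ℂ) (G' (x - (1 / 2 : ℝ) • t))) := by
    have h1 := memLp_two_comp_affine hGm hG x (r := 1 / 2) (by norm_num)
    have h2 := (memLp_two_comp_affine hGm' hG' x (r := -(1 / 2)) (by norm_num)).star
    refine (h1.integrable_mul h2).congr (Eventually.of_forall fun t => ?_)
    simp [sub_eq_add_neg]
  -- the change of variables in phase space
  set Ψ : (ι → ℝ) × (ι → ℝ) → (ι → ℝ) × (ι → ℝ) := fun z =>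
    (c * x - s * z.1 + (1 / 2 : ℝ) • z.2, c * x - s * z.1 - (1 / 2 : ℝ) • z.2) with hΨ
  have hΨm : Measurable Ψ := by rw [hΨ]; fun_prop
  have hΨmap : Measure.map Ψ volume = ENNReal.ofReal N • volume := hmap (c * x)
  -- T is the integrand of the product of the two fractional integrals. Pulled back by Ψ it is the
  -- Wigner integrand of F, F' times the inversion character.
  set T : (ι → ℝ) → (ι → ℝ) × (ι → ℝ) → ℂ := fun t z =>
    (F z.1 * chr (fracPhase c s (x + (1 / 2 : ℝ) • t) z.1)) *
      (starRingEnd ℂ) (F' z.2 * chr (fracPhase c s (x - (1 / 2 : ℝ) • t) z.2)) with hT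
  have hTi : ∀ t, Integrable (T t) (Measure.map Ψ volume) := by
    intro t
    rw [hΨmap]
    refine Integrable.smul_measure ?_ ENNReal.ofReal_ne_top
    have h2 : Integrable fun p =>
        (starRingEnd ℂ) (F' p * chr (fracPhase c s (x - (1 / 2 : ℝ) • t) p)) :=
      memLp_one_iff_integrable.1
        (memLp_one_iff_integrable.2 (integrable_mul_chr_fracPhase _ hF')).star
    exact (integrable_mul_chr_fracPhase _ hF).mul_prod h2
  have hTΨ : ∀ (t ξ τ : ι → ℝ), T t (Ψ (ξ, τ)) =
      F (c * x - s * ξ + (1 / 2 : ℝ) • τ) *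
        (starRingEnd ℂ) (F' (c * x - s * ξ - (1 / 2 : ℝ) • τ)) *
        chr ((s * x + c * ξ) ⬝ᵥ τ) * chr (-(t ⬝ᵥ ξ)) := by
    intro t ξ τ
    rw [mul_assoc _ (chr _) (chr _), ← chr_add, fracPhase_sub_fracPhase hs hcs, chr_add,
      ← conj_chr]
    simp only [hT, hΨ, map_mul]
    ring
  have hTΨi : ∀ t, Integrable (fun z => T t (Ψ z)) (volume.prod volume) := fun t =>
    (hTi t).comp_measurable hΨm
  have hRi : Integrable fun ξ => wig F F' (c * x - s * ξ) (s * x + c * ξ) := by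
    have := (hTΨi 0).integral_prod_left
    refine this.congr (Eventually.of_forall fun ξ => ?_)
    simp only [hTΨ, wig, zero_dotProduct, neg_zero, chr_zero, mul_one]
  -- At fixed x the Wigner distribution of G, G' is the transform in t of the correlation product.
  -- Inversion is legitimate because integrability of F and F' makes the rotated side integrable in
  -- ξ.
  have hinv := ae_eq_integral_of_integral_chr_ae_eq hGG hRi hx
  filter_upwards [hinv] with t ht
  rw [ht]
  calc ∫ ξ, wig F F' (c * x - s * ξ) (s * x + c * ξ) * chr (-(t ⬝ᵥ ξ))
      = ∫ ξ, ∫ τ, T t (Ψ (ξ, τ)) := by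
        congr 1 with ξ
        simp only [hTΨ, wig]
        rw [integral_mul_const]
    _ = ∫ z, T t (Ψ z) := by
        rw [Measure.volume_eq_prod, integral_prod _ (hTΨi t)]
    _ = ∫ z, T t z ∂(Measure.map Ψ volume) :=
        (integral_map hΨm.aemeasurable (hTi t).aestronglyMeasurable).symm
    _ = N * ∫ z, T t z := by
        rw [hΨmap, integral_smul_measure, ENNReal.toReal_ofReal hN.le]
        simp
    _ = _ := by
        rw [hT, Measure.volume_eq_prod]
        simp only []
        rw [integral_prod_mul (fun p => F p * chr (fracPhase c s (x + (1 / 2 : ℝ) • t) p))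
          (fun p => (starRingEnd ℂ) (F' p * chr (fracPhase c s (x - (1 / 2 : ℝ) • t) p))),
          integral_conj]
        rfl

end Kernel

/-! ### Null sets and slices -/

section Prod

variable {A B : Type*} [MeasureSpace A] [MeasureSpace B] [SFinite (volume : Measure A)]
  [SFinite (volume : Measure B)]

theorem ae_slice_of_ae {P : A × B → Prop} (h : ∀ᵐ z, P z) : ∀ᵐ y : B, ∀ᵐ p : A, P (p, y) := by
  have := (Measure.measurePreserving_swap (μ := (volume : Measure B))
    (ν := (volume : Measure A))).quasiMeasurePreserving.ae h
  exact Measure.ae_ae_of_ae_prod this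

theorem ae_of_ae_slice {P : A × B → Prop} (hP : MeasurableSet {z | P z})
    (h : ∀ᵐ y : B, ∀ᵐ p : A, P (p, y)) : ∀ᵐ z, P z := by
  rw [Measure.volume_eq_prod, Measure.ae_prod_iff_ae_ae hP]
  exact (Measure.ae_ae_comm (p := fun y p => P (p, y)) (measurable_swap hP)).1 h

end Prod

/-! ### Removing the chirps -/

section Chirp

variable {ι : Type*} [Fintype ι] {F : (ι → ℝ) → ℂ} {c s : ι → ℝ}

/-- The quadratic phase `∑ c p² / (2s)`. -/
noncomputable def chirpPhase (c s p : ι → ℝ) : ℝ := ∑ i, c i / (2 * s i) * p i ^ 2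

theorem continuous_chirpPhase (c s : ι → ℝ) : Continuous (chirpPhase c s) := by
  unfold chirpPhase; fun_prop

/-- The squares in the phase come out as unimodular chirps, and the scaling by s cancels the 1/s in
the bilinear term. -/
theorem fracInt_mul_eq (hs : ∀ i, s i ≠ 0) (η : ι → ℝ) :
    fracInt c s F (s * η) = chr (-chirpPhase c s (s * η)) *
      ∫ p, F p * chr (-chirpPhase c s p) * chr (η ⬝ᵥ p) := by
  unfold fracInt
  rw [← integral_const_mul]
  congr 1 with p
  have : fracPhase c s (s * η) p =
      -chirpPhase c s (s * η) + (-chirpPhase c s p + η ⬝ᵥ p) := by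
    unfold fracPhase chirpPhase dotProduct
    rw [← Finset.sum_neg_distrib, ← Finset.sum_neg_distrib, ← Finset.sum_add_distrib,
      ← Finset.sum_add_distrib]
    refine Finset.sum_congr rfl fun i _ => ?_
    have := hs i
    simp only [Pi.mul_apply]
    field_simp
    ring
  rw [this, chr_add, chr_add]
  ring

theorem integrable_mul_chr_chirp (hF : Integrable F) :
    Integrable fun p => F p * chr (-chirpPhase c s p) :=
  hF.mul_bdd (c := 1)
    (continuous_chr.comp (continuous_chirpPhase c s).neg).aestronglyMeasurable (by simp)

/-- Continuity upgrades the vanishing to every point, so the ordinary transform of the chirped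
function is identically zero. -/
theorem ae_eq_zero_of_fracInt_ae_eq_zero (hs : ∀ i, s i ≠ 0) (hF : Integrable F)
    (h : ∀ᵐ u, fracInt c s F u = 0) : F =ᵐ[volume] 0 := by
  have hall : fracInt c s F = fun _ => 0 :=
    ((continuous_fracInt c s hF).ae_eq_iff_eq volume continuous_const).1 h
  have hne : ∀ r, chr r ≠ 0 := fun r => norm_ne_zero_iff.1 (by simp)
  have := ae_eq_of_integral_chr_eq (integrable_mul_chr_chirp (c := c) (s := s) hF)
    (integrable_zero _ _ _) (fun η => by
      have h1 := fracInt_mul_eq (F := F) (c := c) hs η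
      rw [hall] at h1
      have h2 := (mul_eq_zero.1 h1.symm).resolve_left (hne _)
      simpa using h2)
  filter_upwards [this] with p hp
  exact (mul_eq_zero.1 hp).resolve_right (hne _)

end Chirp

/-! ### Hardy's theorem on almost every slice -/

section Core

variable {ι κ : Type*} [Fintype ι] [Fintype κ] {F G : (ι → ℝ) × (κ → ℝ) → ℂ} {c s : ι → ℝ}
  {a b : ℝ} {α β : (κ → ℝ) → ℝ}

theorem integrable_slices (hFm : StronglyMeasurable F) (ha : 0 < a)
    (hFb : ∀ᵐ z : (ι → ℝ) × (κ → ℝ), ‖F z‖ ≤ α z.2 * Real.exp (-Real.pi * a * ∑ i, z.1 i ^ 2)) :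
    ∀ᵐ y : κ → ℝ, Integrable fun p => F (p, y) := by
  filter_upwards [ae_slice_of_ae hFb] with y hy
  exact integrable_of_gaussian_bound ha
    (hFm.comp_measurable (by fun_prop)).aestronglyMeasurable hy

theorem not_ae_slice_eq_zero (hFm : StronglyMeasurable F) (hF0 : ¬ F =ᵐ[volume] 0) :
    ∃ᶠ y in ae (volume : Measure (κ → ℝ)), ¬ (fun p => F (p, y)) =ᵐ[volume] 0 := by
  intro h
  refine hF0 (ae_of_ae_slice (P := fun z => F z = 0)
    (hFm.measurableSet_eq_fun stronglyMeasurable_const) ?_)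
  filter_upwards [h] with y hy
  exact not_not.1 hy

/-- Covariance of the Wigner distribution under the partial rotation yields the decay of the
fractional Fourier integrals of almost all slices. -/
theorem fracInt_slice_bound (hFm : StronglyMeasurable F) (hGm : StronglyMeasurable G)
    (hF : MemLp F 2) (hG : MemLp G 2) (hF0 : ¬ F =ᵐ[volume] 0)
    (hs : ∀ i, s i ≠ 0) (hcs : ∀ i, c i ^ 2 + s i ^ 2 = 1) (ha : 0 < a)
    (hFb : ∀ᵐ z : (ι → ℝ) × (κ → ℝ), ‖F z‖ ≤ α z.2 * Real.exp (-Real.pi * a * ∑ i, z.1 i ^ 2))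
    (hGb : ∀ᵐ z : (ι → ℝ) × (κ → ℝ), ‖G z‖ ≤ β z.2 * Real.exp (-Real.pi * b * ∑ i, z.1 i ^ 2))
    (hW : ∀ (x ξ : ι → ℝ) (y η : κ → ℝ), ∫ t : (ι → ℝ) × (κ → ℝ),
        G (x + (1 / 2 : ℝ) • t.1, y + (1 / 2 : ℝ) • t.2) *
          (starRingEnd ℂ) (G (x - (1 / 2 : ℝ) • t.1, y - (1 / 2 : ℝ) • t.2)) *
          chr (ξ ⬝ᵥ t.1 + η ⬝ᵥ t.2) =
      ∫ t : (ι → ℝ) × (κ → ℝ),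
        F (c * x - s * ξ + (1 / 2 : ℝ) • t.1, y + (1 / 2 : ℝ) • t.2) *
          (starRingEnd ℂ) (F (c * x - s * ξ - (1 / 2 : ℝ) • t.1, y - (1 / 2 : ℝ) • t.2)) *
          chr ((s * x + c * ξ) ⬝ᵥ t.1 + η ⬝ᵥ t.2)) :
    ∀ᵐ y : κ → ℝ, ∃ D : ℝ, ∀ u, ‖fracInt c s (fun p => F (p, y)) u‖ ≤
      D * Real.exp (-Real.pi * b * ∑ i, u i ^ 2) := by
  have hpair : ∀ q : (ι → ℝ) × (ι → ℝ), ∀ᵐ w : (κ → ℝ) × (κ → ℝ),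
      wig (fun p => G (p, w.1)) (fun p => G (p, w.2)) q.1 q.2 =
      wig (fun p => F (p, w.1)) (fun p => F (p, w.2)) (c * q.1 - s * q.2) (s * q.1 + c * q.2) := by
    intro q
    apply ae_of_ae_add_sub_half
    rw [Measure.volume_eq_prod, Measure.ae_prod_iff_ae_ae]
    · exact Eventually.of_forall fun y => wig_slice_ae_eq hFm hGm hF hG _ _ _ _ y (hW q.1 q.2 y)
    · exact StronglyMeasurable.measurableSet_eq_fun
        (stronglyMeasurable_wig_slice hGm (by fun_prop) (by fun_prop) (by fun_prop) (by fun_prop))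
        (stronglyMeasurable_wig_slice hFm (by fun_prop) (by fun_prop) (by fun_prop) (by fun_prop))
  -- The exceptional set of slices depends on q; Fubini exchanges the quantifiers so that a single
  -- pair of slices serves almost every phase-space point.
  have hpair' : ∀ᵐ w : (κ → ℝ) × (κ → ℝ), ∀ᵐ q : (ι → ℝ) × (ι → ℝ),
      wig (fun p => G (p, w.1)) (fun p => G (p, w.2)) q.1 q.2 =
      wig (fun p => F (p, w.1)) (fun p => F (p, w.2)) (c * q.1 - s * q.2) (s * q.1 + c * q.2) := by
    have hS : MeasurableSet {x : ((ι → ℝ) × (ι → ℝ)) × ((κ → ℝ) × (κ → ℝ)) |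
        wig (fun p => G (p, x.2.1)) (fun p => G (p, x.2.2)) x.1.1 x.1.2 =
        wig (fun p => F (p, x.2.1)) (fun p => F (p, x.2.2)) (c * x.1.1 - s * x.1.2)
          (s * x.1.1 + c * x.1.2)} :=
      StronglyMeasurable.measurableSet_eq_fun
        (stronglyMeasurable_wig_slice hGm (by fun_prop) (by fun_prop) (by fun_prop) (by fun_prop))
        (stronglyMeasurable_wig_slice hFm (by fun_prop) (by fun_prop) (by fun_prop) (by fun_prop))
    exact (Measure.ae_ae_comm hS).1 (Eventually.of_forall hpair)
  obtain ⟨N, hN, htensor⟩ := tensor_ae_eq_of_wig_eq (ι := ι) hs hcs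
  have hFi := integrable_slices hFm ha hFb
  have hGs : ∀ y, StronglyMeasurable fun p => G (p, y) := fun y =>
    hGm.comp_measurable (by fun_prop)
  have hG2 : ∀ᵐ y : κ → ℝ, MemLp (fun p => G (p, y)) 2 := by
    have h1 := ((memLp_two_iff_integrable_sq_norm hGm.aestronglyMeasurable).1 hG).prod_left_ae
    filter_upwards [h1] with y hy
    exact (memLp_two_iff_integrable_sq_norm (hGs y).aestronglyMeasurable).2 hy
  -- A reference slice: nonzero, and good against almost every other y. Its fractional integral is
  -- nonzero at some v, by which the tensor identity is then divided.
  obtain ⟨y', hw0, hwW, hwF, hwG⟩ := ((not_ae_slice_eq_zero hFm hF0).and_eventually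
    ((ae_slice_of_ae hpair').and (hFi.and hG2))).exists
  have hP' : ∃ᶠ v in ae (volume : Measure (ι → ℝ)), fracInt c s (fun p => F (p, y')) v ≠ 0 := by
    intro h
    refine hw0 (ae_eq_zero_of_fracInt_ae_eq_zero (c := c) hs hwF ?_)
    filter_upwards [h] with v hv
    exact not_not.1 hv
  filter_upwards [hwW, hFi, hG2, ae_slice_of_ae hGb] with y hyW hyF hyG hyb
  have ht := htensor _ _ _ _ (hGs y) (hGs y') hyF hwF hyG hwG hyW
  obtain ⟨v, hv0, hv⟩ := (hP'.and_eventually (ae_slice_of_ae ht)).exists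
  set P' := fracInt c s (fun p => F (p, y')) v
  have hPpos : 0 < ‖P'‖ := norm_pos_iff.2 hv0
  set D := β y * ‖G (v, y')‖ / (N * ‖P'‖) with hD
  refine ⟨D, ?_⟩
  have hae : ∀ᵐ u, ‖fracInt c s (fun p => F (p, y)) u‖ ≤
      D * Real.exp (-Real.pi * b * ∑ i, u i ^ 2) := by
    filter_upwards [hv, hyb] with u hu hub
    have h1 := congrArg norm hu
    simp only [norm_mul, RCLike.norm_conj, Complex.norm_real, Real.norm_of_nonneg hN.le] at h1
    have h2 : ‖fracInt c s (fun p => F (p, y)) u‖ = ‖G (u, y)‖ * ‖G (v, y')‖ / (N * ‖P'‖) := by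
      rw [h1]; field_simp; rfl
    rw [h2]
    calc _ ≤ (β y * Real.exp (-Real.pi * b * ∑ i, u i ^ 2)) * ‖G (v, y')‖ / (N * ‖P'‖) := by
          gcongr
      _ = _ := by rw [hD]; ring
  -- Both sides are continuous in u, so a bound on a dense set holds everywhere.
  have hcl : IsClosed {u | ‖fracInt c s (fun p => F (p, y)) u‖ ≤
      D * Real.exp (-Real.pi * b * ∑ i, u i ^ 2)} :=
    isClosed_le (continuous_fracInt c s hyF).norm (by fun_prop)
  intro u
  have := (Measure.dense_of_ae hae).closure_eq
  rw [hcl.closure_eq] at this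
  exact Set.eq_univ_iff_forall.1 this u

/-- Hardy's theorem for slices, phrased with the fractional Fourier integrals. -/
theorem hardy_slices [DecidableEq ι] (hFm : StronglyMeasurable F)
    (hF : MemLp F 2) (hF0 : ¬ F =ᵐ[volume] 0) (hs : ∀ i, s i ≠ 0) (ha : 0 < a) (hb : 0 < b)
    (hFb : ∀ᵐ z : (ι → ℝ) × (κ → ℝ), ‖F z‖ ≤ α z.2 * Real.exp (-Real.pi * a * ∑ i, z.1 i ^ 2))
    (hP : ∀ᵐ y : κ → ℝ, ∃ D : ℝ, ∀ u, ‖fracInt c s (fun p => F (p, y)) u‖ ≤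
      D * Real.exp (-Real.pi * b * ∑ i, u i ^ 2)) :
    (∀ j, a * b * s j ^ 2 ≤ 1) ∧ ((∀ j, a * b * s j ^ 2 = 1) →
      ∃ γ : (κ → ℝ) → ℂ, MemLp γ 2 ∧ ∀ᵐ z : (ι → ℝ) × (κ → ℝ), F z = γ z.2 *
        ∏ i, Complex.exp (-Real.pi * ((a : ℂ) + Complex.I * ((c i / s i : ℝ) : ℂ)) *
          (z.1 i : ℂ) ^ 2)) := by
  have hFs : ∀ y, StronglyMeasurable fun p => F (p, y) := fun y =>
    hFm.comp_measurable (by fun_prop)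
  have hne : ∀ r, chr r ≠ 0 := fun r => norm_ne_zero_iff.1 (by simp)
  have hmeas : ∀ y, AEStronglyMeasurable fun p => F (p, y) * chr (-chirpPhase c s p) := fun y =>
    (hFs y).aestronglyMeasurable.mul
      (continuous_chr.comp (continuous_chirpPhase c s).neg).aestronglyMeasurable
  have hchirp : ∀ᵐ y : κ → ℝ,
      (∀ᵐ p, ‖F (p, y) * chr (-chirpPhase c s p)‖ ≤
        α y * Real.exp (-Real.pi * a * ∑ i, p i ^ 2)) ∧
      ∃ D : ℝ, ∀ η : ι → ℝ, ‖∫ p, F (p, y) * chr (-chirpPhase c s p) * chr (η ⬝ᵥ p)‖ ≤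
        D * Real.exp (-Real.pi * b * ∑ i, s i ^ 2 * η i ^ 2) := by
    filter_upwards [hP, ae_slice_of_ae hFb] with y ⟨D, hD⟩ hy
    refine ⟨by simpa using hy, D, fun η => ?_⟩
    have h1 := hD (s * η)
    rw [fracInt_mul_eq hs, norm_mul, norm_chr, one_mul] at h1
    simpa [mul_pow] using h1
  constructor
  · intro j
    by_contra! hj
    obtain ⟨y, hy0, hy1, D, hy2⟩ := ((not_ae_slice_eq_zero hFm hF0).and_eventually hchirp).exists
    refine hy0 ?_
    filter_upwards [ae_eq_zero_of_hardy ha hb (hmeas y) hy1 hy2 j hj] with p hp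
    exact (mul_eq_zero.1 hp).resolve_right (hne _)
  · intro hcrit
    -- E is the Gaussian times the inverse of the chirp that multiplied the slice, which is the
    -- source of cot θ_j = c_j / s_j.
    set E : (ι → ℝ) → ℂ := fun p => ∏ i, Complex.exp (-Real.pi * ((a : ℂ) +
      Complex.I * ((c i / s i : ℝ) : ℂ)) * (p i : ℂ) ^ 2) with hE
    have hEc : Continuous E := by rw [hE]; fun_prop
    have hEeq : ∀ p, E p = Complex.exp (-(Real.pi * a : ℝ) * ∑ i, (p i : ℂ) ^ 2) *
        chr (chirpPhase c s p) := by
      intro p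
      simp only [hE, chr, chirpPhase, ← Complex.exp_sum, ← Complex.exp_add]
      congr 1
      push_cast
      rw [Finset.mul_sum, Finset.mul_sum, ← Finset.sum_add_distrib]
      refine Finset.sum_congr rfl fun i _ => ?_
      have : (s i : ℂ) ≠ 0 := by exact_mod_cast hs i
      field_simp
      ring
    have hEn : ∀ p, ‖E p‖ = Real.exp (-(Real.pi * a) * ∑ i, p i ^ 2) := by
      intro p
      rw [hEeq, norm_mul, norm_chr, mul_one, Complex.norm_exp]
      congr 1
      simp only [← Complex.ofReal_pow, ← Complex.ofReal_sum, ← Complex.ofReal_neg,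
        ← Complex.ofReal_mul, Complex.ofReal_re]
    have hE0 : ∀ p, E p ≠ 0 := fun p => norm_ne_zero_iff.1 (by rw [hEn]; positivity)
    have hEE : ∀ p, E p * (starRingEnd ℂ) (E p) =
        (Real.exp (-(2 * (Real.pi * a)) * ∑ i, p i ^ 2) : ℝ) := by
      intro p
      rw [Complex.mul_conj, Complex.normSq_eq_norm_sq, hEn, ← Real.exp_nat_mul]
      congr 2; push_cast; ring
    set M : ℂ := ∫ p, E p * (starRingEnd ℂ) (E p) with hM
    have hM0 : M ≠ 0 := by
      rw [hM]
      simp only [hEE]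
      rw [integral_complex_ofReal]
      have hgi : Integrable (fun p : ι → ℝ => Real.exp (-(2 * (Real.pi * a)) * ∑ i, p i ^ 2)) :=
        integrable_gaussian_pi (by positivity)
      exact_mod_cast (integral_exp_pos hgi).ne'
    -- Choosing L separately on each slice would give no measurability in y; pairing with E recovers
    -- the same coefficient as a parametric integral.
    set γ : (κ → ℝ) → ℂ := fun y => (∫ p, F (p, y) * (starRingEnd ℂ) (E p)) / M with hγ
    have hγm : StronglyMeasurable γ := by
      simp only [hγ, div_eq_mul_inv]
      refine StronglyMeasurable.mul_const ?_ M⁻¹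
      refine StronglyMeasurable.integral_prod_right' (f := fun q : (κ → ℝ) × (ι → ℝ) =>
        F (q.2, q.1) * (starRingEnd ℂ) (E q.2)) ?_
      exact (hFm.comp_measurable (by fun_prop)).mul
        (Continuous.stronglyMeasurable (RCLike.continuous_conj.comp (hEc.comp continuous_snd)))
    have hae : ∀ᵐ z : (ι → ℝ) × (κ → ℝ), F z = γ z.2 * E z.1 := by
      refine ae_of_ae_slice (hFm.measurableSet_eq_fun
        ((hγm.comp_measurable measurable_snd).mul
          (hEc.comp continuous_fst).stronglyMeasurable)) ?_
      filter_upwards [hchirp] with y ⟨hy1, D, hy2⟩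
      obtain ⟨L, hL⟩ := ae_eq_gaussian_of_hardy ha hb (hmeas y) hy1 hy2 hcrit
      have hFL : ∀ᵐ p, F (p, y) = L * E p := by
        filter_upwards [hL] with p hp
        rw [hEeq, ← mul_assoc, ← hp, mul_assoc, ← chr_add, neg_add_cancel, chr_zero, mul_one]
      have hγL : γ y = L := by
        have h1 : ∫ p, F (p, y) * (starRingEnd ℂ) (E p) = L * M := by
          rw [hM, ← integral_const_mul]
          refine integral_congr_ae ?_
          filter_upwards [hFL] with p hp
          rw [hp, mul_assoc]
        simp only [hγ]
        rw [h1, mul_div_cancel_right₀ _ hM0]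
      filter_upwards [hFL] with p hp
      simp only [hγL, hp]
    refine ⟨γ, ?_, hae⟩
    rw [memLp_two_iff_integrable_sq_norm hγm.aestronglyMeasurable]
    have h1 := ((memLp_two_iff_integrable_sq_norm hFm.aestronglyMeasurable).1 hF).prod_right_ae
    -- One good p suffices: F(p, ·) is square integrable and equals γ times the nonzero constant E
    -- p.
    obtain ⟨p, hp1, hp2⟩ := (h1.and (Measure.ae_ae_of_ae_prod hae)).exists
    refine (hp1.div_const (‖E p‖ ^ 2)).congr ?_
    filter_upwards [hp2] with y hy
    have : ‖E p‖ ≠ 0 := norm_ne_zero_iff.2 (hE0 p)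
    rw [hy, norm_mul]
    field_simp

end Core

/-! ### Splitting the coordinates, with signs -/

section Glue

variable {ι κ : Type*} {d : ℕ} (σ : ι ⊕ κ ≃ Fin d)

/-- The identification of `ℝ^ι × ℝ^κ` with `ℝᵈ` given by a splitting of the coordinates. -/
noncomputable def glue : (ι → ℝ) × (κ → ℝ) ≃ᵐ EuclideanSpace ℝ (Fin d) :=
  (MeasurableEquiv.sumPiEquivProdPi (fun _ : ι ⊕ κ => ℝ)).symm.trans
    ((MeasurableEquiv.piCongrLeft (fun _ => ℝ) σ).trans (MeasurableEquiv.toLp 2 _))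

theorem measurePreserving_glue [Fintype ι] [Fintype κ] : MeasurePreserving (glue σ) :=
  (PiLp.volume_preserving_toLp (Fin d)).comp
    ((volume_measurePreserving_piCongrLeft (fun _ => ℝ) σ).comp
      (volume_measurePreserving_sumPiEquivProdPi_symm (fun _ : ι ⊕ κ => ℝ)))

@[simp] theorem glue_inl (z : (ι → ℝ) × (κ → ℝ)) (i : ι) : glue σ z (σ (Sum.inl i)) = z.1 i :=
  Equiv.piCongrLeft_apply_apply (fun _ => ℝ) σ _ (Sum.inl i)

@[simp] theorem glue_inr (z : (ι → ℝ) × (κ → ℝ)) (i : κ) : glue σ z (σ (Sum.inr i)) = z.2 i :=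
  Equiv.piCongrLeft_apply_apply (fun _ => ℝ) σ _ (Sum.inr i)

theorem glue_ext {x y : EuclideanSpace ℝ (Fin d)} (h1 : ∀ i, x (σ (Sum.inl i)) = y (σ (Sum.inl i)))
    (h2 : ∀ i, x (σ (Sum.inr i)) = y (σ (Sum.inr i))) : x = y := by
  ext j
  obtain ⟨i | i, rfl⟩ := σ.surjective j
  · exact h1 i
  · exact h2 i

/-- The sign change `y ↦ ε y` for `ε = ±1` coordinatewise. -/
noncomputable def signFlip (ε : κ → ℝ) (hε : ∀ i, ε i * ε i = 1) : (κ → ℝ) ≃ᵐ (κ → ℝ) where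
  toFun y := ε * y
  invFun y := ε * y
  left_inv y := by ext i; simp [← mul_assoc, hε]
  right_inv y := by ext i; simp [← mul_assoc, hε]
  measurable_toFun := by dsimp; fun_prop
  measurable_invFun := by dsimp; fun_prop

theorem measurePreserving_signFlip [Fintype κ] (ε : κ → ℝ) (hε : ∀ i, ε i * ε i = 1) :
    MeasurePreserving (fun y : κ → ℝ => ε * y) := by
  refine volume_preserving_pi (f := fun i (r : ℝ) => ε i * r) fun i => ?_
  rcases mul_self_eq_one_iff.1 (hε i) with h | h
  · simpa [h] using! MeasurePreserving.id (volume : Measure ℝ)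
  · simpa [h] using Measure.measurePreserving_neg (volume : Measure ℝ)

/-- The identification of `ℝ^ι × ℝ^κ` with `ℝᵈ`, with signs in the second factor. -/
noncomputable def glueSign (ε : κ → ℝ) (hε : ∀ i, ε i * ε i = 1) :
    (ι → ℝ) × (κ → ℝ) ≃ᵐ EuclideanSpace ℝ (Fin d) :=
  ((MeasurableEquiv.refl (ι → ℝ)).prodCongr (signFlip ε hε)).trans (glue σ)

theorem glueSign_apply (ε : κ → ℝ) (hε : ∀ i, ε i * ε i = 1) (z : (ι → ℝ) × (κ → ℝ)) :
    glueSign σ ε hε z = glue σ (z.1, ε * z.2) := rfl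

theorem measurePreserving_glueSign [Fintype ι] [Fintype κ] (ε : κ → ℝ) (hε : ∀ i, ε i * ε i = 1) :
    MeasurePreserving (glueSign σ ε hε) :=
  (measurePreserving_glue σ).comp
    ((MeasurePreserving.id volume).prod (measurePreserving_signFlip ε hε))

theorem glueSign_add_smul (ε : κ → ℝ) (hε : ∀ i, ε i * ε i = 1) (z t : (ι → ℝ) × (κ → ℝ)) (r : ℝ) :
    glueSign σ ε hε (z + r • t) = glueSign σ ε hε z + r • glueSign σ ε hε t := by
  refine glue_ext σ (fun i => ?_) fun i => ?_
  · simp [glueSign_apply]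
  · simp [glueSign_apply]; ring

theorem inner_glueSign [Fintype ι] [Fintype κ] (ε : κ → ℝ) (hε : ∀ i, ε i * ε i = 1)
    (z w : (ι → ℝ) × (κ → ℝ)) :
    inner ℝ (glueSign σ ε hε z) (glueSign σ ε hε w) = z.1 ⬝ᵥ w.1 + z.2 ⬝ᵥ w.2 := by
  rw [PiLp.inner_apply, ← Equiv.sum_comp σ, Fintype.sum_sum_type]
  simp only [glueSign_apply, glue_inl, glue_inr, dotProduct, RCLike.inner_apply, conj_trivial,
    Pi.mul_apply]
  congr 1
  · exact Finset.sum_congr rfl fun i _ => mul_comm _ _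
  · refine Finset.sum_congr rfl fun i _ => ?_
    linear_combination (z.2 i * w.2 i) * hε i

theorem crossWigner_glueSign [Fintype ι] [Fintype κ] (ε : κ → ℝ) (hε : ∀ i, ε i * ε i = 1)
    (f : EuclideanSpace ℝ (Fin d) → ℂ) (z w : (ι → ℝ) × (κ → ℝ)) :
    crossWigner f f (glueSign σ ε hε z) (glueSign σ ε hε w) =
      ∫ t : (ι → ℝ) × (κ → ℝ),
        f (glueSign σ ε hε (z.1 + (1 / 2 : ℝ) • t.1, z.2 + (1 / 2 : ℝ) • t.2)) *
        (starRingEnd ℂ) (f (glueSign σ ε hε (z.1 - (1 / 2 : ℝ) • t.1, z.2 - (1 / 2 : ℝ) • t.2))) *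
        chr (w.1 ⬝ᵥ t.1 + w.2 ⬝ᵥ t.2) := by
  unfold crossWigner
  rw [← (measurePreserving_glueSign σ ε hε).integral_comp (glueSign σ ε hε).measurableEmbedding]
  congr 1 with t
  have h1 : (z.1 + (1 / 2 : ℝ) • t.1, z.2 + (1 / 2 : ℝ) • t.2) = z + (1 / 2 : ℝ) • t := rfl
  have h2 : (z.1 - (1 / 2 : ℝ) • t.1, z.2 - (1 / 2 : ℝ) • t.2) = z + (-(1 / 2) : ℝ) • t := by
    rw [neg_smul, ← sub_eq_add_neg]; rfl
  rw [h1, h2, glueSign_add_smul, glueSign_add_smul, inner_glueSign, neg_smul, ← sub_eq_add_neg]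
  rfl

end Glue

/-! ### The inverse rotation in coordinates -/

section Rotation

variable {d : ℕ}

theorem fracMatrix_inv_mulVec (θ : Fin d → ℝ) (x ξ : Fin d → ℝ) :
    Matrix.mulVec (fracMatrix θ)⁻¹ (Sum.elim x ξ) =
      Sum.elim (fun j => Real.cos (θ j) * x j - Real.sin (θ j) * ξ j)
        (fun j => Real.sin (θ j) * x j + Real.cos (θ j) * ξ j) := by
  have hdet : IsUnit (fracMatrix θ).det := SymplecticGroup.symplectic_det (fracMatrix_mem θ)
  have h : Sum.elim x ξ = Matrix.mulVec (fracMatrix θ)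
      (Sum.elim (fun j => Real.cos (θ j) * x j - Real.sin (θ j) * ξ j)
        (fun j => Real.sin (θ j) * x j + Real.cos (θ j) * ξ j)) := by
    unfold fracMatrix
    rw [Matrix.fromBlocks_mulVec]
    ext (j | j)
    · simp [Matrix.mulVec_diagonal]
      linear_combination (-x j) * Real.sin_sq_add_cos_sq (θ j)
    · simp [Matrix.mulVec_diagonal]
      linear_combination (-ξ j) * Real.sin_sq_add_cos_sq (θ j)
  rw [h, Matrix.mulVec_mulVec, Matrix.nonsing_inv_mul _ hdet, Matrix.one_mulVec]

theorem crossWigner_fracFourier {θ : Fin d → ℝ} {U : L2 d ≃ₗᵢ[ℂ] L2 d} (hU : IsFracFourier θ U)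
    (f g : L2 d) (x ξ : EuclideanSpace ℝ (Fin d)) :
    crossWigner (U f) (U g) x ξ = crossWigner f g
      (WithLp.toLp 2 fun j => Real.cos (θ j) * x j - Real.sin (θ j) * ξ j)
      (WithLp.toLp 2 fun j => Real.sin (θ j) * x j + Real.cos (θ j) * ξ j) := by
  have h := hU f g (Sum.elim x.ofLp ξ.ofLp)
  simp only [fracSymplectic, fracMatrix_inv_mulVec] at h
  exact h

end Rotation

/-! ### Assembly in ℝᵈ -/

/-- The splitting of the coordinates into a finset and its complement. -/
def splitEquiv {d : ℕ} (J : Finset (Fin d)) : J ⊕ (Jᶜ : Finset (Fin d)) ≃ Fin d :=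
  (Equiv.sumCongr (Equiv.refl _) (Equiv.subtypeEquivRight fun _ => Finset.mem_compl)).trans
    (Equiv.sumCompl (· ∈ J))

theorem splitEquiv_inl {d : ℕ} (J : Finset (Fin d)) (i : J) : splitEquiv J (Sum.inl i) = i := rfl

theorem splitEquiv_inr {d : ℕ} (J : Finset (Fin d)) (i : (Jᶜ : Finset (Fin d))) :
    splitEquiv J (Sum.inr i) = i := rfl

section Split

variable {d : ℕ} (J : Finset (Fin d)) (ε : (Jᶜ : Finset (Fin d)) → ℝ)
  (hε : ∀ i, ε i * ε i = 1) (z : (J → ℝ) × ((Jᶜ : Finset (Fin d)) → ℝ))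

theorem glueSign_split_mem (i : J) : glueSign (splitEquiv J) ε hε z i = z.1 i :=
  glue_inl (splitEquiv J) (z.1, ε * z.2) i

theorem glueSign_split_compl (i : (Jᶜ : Finset (Fin d))) :
    glueSign (splitEquiv J) ε hε z i = ε i * z.2 i :=
  glue_inr (splitEquiv J) (z.1, ε * z.2) i

theorem coords_glueSign : coords J (glueSign (splitEquiv J) ε hε z) = WithLp.toLp 2 z.1 := by
  ext i; exact glueSign_split_mem J ε hε z i

theorem coords_compl_glueSign :
    coords Jᶜ (glueSign (splitEquiv J) ε hε z) = WithLp.toLp 2 (ε * z.2) := by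
  ext i; exact glueSign_split_compl J ε hε z i

theorem gaussian_bound_comp_glueSign {f : EuclideanSpace ℝ (Fin d) → ℂ}
    {α : EuclideanSpace ℝ (Jᶜ : Finset (Fin d)) → ℝ} {a : ℝ}
    (h : ∀ᵐ x, ‖f x‖ ≤ α (coords Jᶜ x) * Real.exp (-Real.pi * a * ‖coords J x‖ ^ 2)) :
    ∀ᵐ z : (J → ℝ) × ((Jᶜ : Finset (Fin d)) → ℝ), ‖f (glueSign (splitEquiv J) ε hε z)‖ ≤
      α (WithLp.toLp 2 (ε * z.2)) * Real.exp (-Real.pi * a * ∑ i, z.1 i ^ 2) := by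
  filter_upwards [(measurePreserving_glueSign (splitEquiv J) ε hε).quasiMeasurePreserving.ae h]
    with z hz
  rw [coords_glueSign, coords_compl_glueSign, EuclideanSpace.norm_sq_eq] at hz
  simpa using hz

end Split

/-- Hardy's uncertainty principle for the fractional Fourier transform, with the splitting of the
coordinates given by a finset `J`. -/
theorem hardy_fracFourier {d : ℕ} {θ : Fin d → ℝ} {J : Finset (Fin d)}
    (hJ : ∀ j ∈ J, Real.sin (θ j) ≠ 0) (hJc : ∀ j ∉ J, Real.sin (θ j) = 0)
    {U : L2 d ≃ₗᵢ[ℂ] L2 d} (hU : IsFracFourier θ U)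
    {a b : ℝ} (ha : 0 < a) (hb : 0 < b) {f : L2 d} (hf : f ≠ 0)
    {α β : EuclideanSpace ℝ (Jᶜ : Finset (Fin d)) → ℝ}
    (hdecay : ∀ᵐ x : EuclideanSpace ℝ (Fin d),
      ‖f x‖ ≤ α (coords Jᶜ x) * Real.exp (-Real.pi * a * ‖coords J x‖ ^ 2))
    (hdecay' : ∀ᵐ ξ : EuclideanSpace ℝ (Fin d),
      ‖U f ξ‖ ≤ β (coords Jᶜ ξ) * Real.exp (-Real.pi * b * ‖coords J ξ‖ ^ 2)) :
    (∀ j, a * b * Real.sin (θ j) ^ 2 ≤ 1) ∧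
    ((∀ j ∈ J, Real.sin (θ j) ^ 2 = 1 / (a * b)) →
      ∃ γ : EuclideanSpace ℝ (Jᶜ : Finset (Fin d)) → ℂ,
        MemLp γ 2 volume ∧
        ∀ᵐ x : EuclideanSpace ℝ (Fin d),
          f x = γ (coords Jᶜ x) *
            ∏ j ∈ J, Complex.exp
              (-Real.pi * ((a : ℂ) + Complex.I * (Real.cot (θ j) : ℂ)) * ((x j : ℝ) : ℂ) ^ 2)) := by
  have hsin : ∀ i : J, Real.sin (θ i) ≠ 0 := fun i => hJ i i.2
  have hsin0 : ∀ i : (Jᶜ : Finset (Fin d)), Real.sin (θ i) = 0 := fun i =>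
    hJc i (Finset.mem_compl.1 i.2)
  -- Off J the rotation is multiplication by cos θ_i = ±1. Building these signs into the coordinates
  -- of f, but not of U f, makes the rotation trivial in the second factor.
  set ε : (Jᶜ : Finset (Fin d)) → ℝ := fun i => Real.cos (θ i) with hεdef
  have hε : ∀ i, ε i * ε i = 1 := fun i => by
    have := Real.sin_sq_add_cos_sq (θ i)
    rw [hsin0 i] at this
    rw [hεdef]; linarith
  have h1 : ∀ i : (Jᶜ : Finset (Fin d)), (1 : (Jᶜ : Finset (Fin d)) → ℝ) i *
      (1 : (Jᶜ : Finset (Fin d)) → ℝ) i = 1 := fun _ => by simp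
  set c : J → ℝ := fun i => Real.cos (θ i) with hc
  set s : J → ℝ := fun i => Real.sin (θ i) with hs
  set gF := glueSign (splitEquiv J) ε hε with hgF
  set gG := glueSign (splitEquiv J) 1 h1 with hgG
  have mpF : MeasurePreserving gF := measurePreserving_glueSign _ ε hε
  have mpG : MeasurePreserving gG := measurePreserving_glueSign _ 1 h1
  have hFm : StronglyMeasurable fun z => f (gF z) :=
    (Lp.stronglyMeasurable f).comp_measurable gF.measurable
  have hGm : StronglyMeasurable fun z => U f (gG z) :=
    (Lp.stronglyMeasurable (U f)).comp_measurable gG.measurable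
  have hF2 : MemLp (fun z => f (gF z)) 2 := (Lp.memLp f).comp_measurePreserving mpF
  have hG2 : MemLp (fun z => U f (gG z)) 2 := (Lp.memLp (U f)).comp_measurePreserving mpG
  have mpF' : MeasurePreserving gF.symm := mpF.symm gF
  have hF0 : ¬ (fun z => f (gF z)) =ᵐ[volume] 0 := by
    intro h
    refine hf ((Lp.eq_zero_iff_ae_eq_zero).2 ?_)
    filter_upwards [mpF'.quasiMeasurePreserving.ae h] with x hx
    simpa using hx
  have hFb := gaussian_bound_comp_glueSign J ε hε hdecay
  have hGb := gaussian_bound_comp_glueSign J 1 h1 hdecay'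
  have hP := fracInt_slice_bound (c := c) (s := s)
    (α := fun y => α (WithLp.toLp 2 (ε * y))) (β := fun y => β (WithLp.toLp 2 (1 * y)))
    hFm hGm hF2 hG2 hF0 hsin
    (fun i => Real.cos_sq_add_sin_sq _) ha hFb hGb (fun x ξ y η => by
      have h := crossWigner_fracFourier hU f f (gG (x, y)) (gG (ξ, η))
      have hx : (WithLp.toLp 2 fun j => Real.cos (θ j) * gG (x, y) j -
          Real.sin (θ j) * gG (ξ, η) j) = gF (c * x - s * ξ, y) := by
        refine glue_ext (splitEquiv J) (fun i => ?_) fun i => ?_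
        · simp [hgF, hgG, splitEquiv_inl, glueSign_split_mem, hc, hs]
        · simp [hgF, hgG, splitEquiv_inr, glueSign_split_compl, hεdef, hsin0]
      have hξ : (WithLp.toLp 2 fun j => Real.sin (θ j) * gG (x, y) j +
          Real.cos (θ j) * gG (ξ, η) j) = gF (s * x + c * ξ, η) := by
        refine glue_ext (splitEquiv J) (fun i => ?_) fun i => ?_
        · simp [hgF, hgG, splitEquiv_inl, glueSign_split_mem, hc, hs]
        · simp [hgF, hgG, splitEquiv_inr, glueSign_split_compl, hεdef, hsin0]
      rw [hx, hξ, hgF, hgG, crossWigner_glueSign, crossWigner_glueSign] at h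
      exact h)
  obtain ⟨hi, hii⟩ := hardy_slices (α := fun y => α (WithLp.toLp 2 (ε * y)))
    hFm hF2 hF0 hsin ha hb hFb hP
  refine ⟨fun j => ?_, fun hcrit => ?_⟩
  · by_cases hj : j ∈ J
    · exact hi ⟨j, hj⟩
    · have := hsin0 ⟨j, Finset.mem_compl.2 hj⟩
      simp only at this
      simp [this]
  · obtain ⟨γ, hγ2, hγ⟩ := hii fun j => by
      rw [hcrit j j.2]; field_simp
    -- γ was found in the sign-changed coordinates; ε is its own inverse, so multiplying by it again
    -- undoes the change.
    refine ⟨fun y => γ (ε * WithLp.ofLp y), ?_, ?_⟩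
    · exact hγ2.comp_measurePreserving ((measurePreserving_signFlip ε hε).comp
        (PiLp.volume_preserving_ofLp _))
    · filter_upwards [mpF'.quasiMeasurePreserving.ae hγ] with x hx
      obtain ⟨z, rfl⟩ := gF.surjective x
      rw [MeasurableEquiv.symm_apply_apply] at hx
      rw [hx, hgF, coords_compl_glueSign]
      congr 1
      · congr 1
        ext i
        simp [← mul_assoc, hε]
      · rw [← Finset.prod_coe_sort J]
        refine Finset.prod_congr rfl fun i _ => ?_
        rw [glueSign_split_mem, Real.cot_eq_cos_div_sin]

end FracFourierHardy

theorem mainTheorem7 {d : ℕ} (θ : Fin d → ℝ) (hθ : ∃ j, Real.sin (θ j) ≠ 0)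
    (U : L2 d ≃ₗᵢ[ℂ] L2 d) (hU : IsFracFourier θ U)
    (a b : ℝ) (ha : 0 < a) (hb : 0 < b)
    (f : L2 d) (hf : f ≠ 0)
    (α β : EuclideanSpace ℝ ((sinIdx θ)ᶜ : Finset (Fin d)) → ℝ)
    (hα : ∀ y, 0 < α y) (hβ : ∀ y, 0 < β y)
    (hdecay : ∀ᵐ x : EuclideanSpace ℝ (Fin d),
      ‖f x‖ ≤ α (coords (sinIdx θ)ᶜ x) * Real.exp (-Real.pi * a * ‖coords (sinIdx θ) x‖ ^ 2))
    (hdecay' : ∀ᵐ ξ : EuclideanSpace ℝ (Fin d),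
      ‖U f ξ‖ ≤ β (coords (sinIdx θ)ᶜ ξ) * Real.exp (-Real.pi * b * ‖coords (sinIdx θ) ξ‖ ^ 2)) :
    (∀ j, a * b * Real.sin (θ j) ^ 2 ≤ 1) ∧
    ((∀ j ∈ sinIdx θ, Real.sin (θ j) ^ 2 = 1 / (a * b)) →
      ∃ γ : EuclideanSpace ℝ ((sinIdx θ)ᶜ : Finset (Fin d)) → ℂ,
        MemLp γ 2 volume ∧
        ∀ᵐ x : EuclideanSpace ℝ (Fin d),
          f x = γ (coords (sinIdx θ)ᶜ x) *
            ∏ j ∈ sinIdx θ, Complex.exp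
              (-Real.pi * ((a : ℂ) + Complex.I * (Real.cot (θ j) : ℂ)) * ((x j : ℝ) : ℂ) ^ 2)) := by
  refine hardy_fracFourier (fun j hj => (Finset.mem_filter.1 hj).2) (fun j hj => ?_) hU ha hb hf
    hdecay hdecay'
  by_contra h
  exact hj (Finset.mem_filter.2 ⟨Finset.mem_univ _, h⟩)
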